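/- Let $N^5_s(c)$ be a $5$-dimensional pseudo-Riemannian manifold of constant sectional curvature $c$ and arbitrary index $s$, and let $x: M^4_r\to N^5_s(c)$ be a connected nondegenerate immersed hypersurface (all objects smooth) with a unit normal vector field $\vec\xi$, $\varepsilon=\langle\vec\xi,\vec\xi\rangle=\pm1$. Let $A$ be the shape operator associated with $\vec\xi$ (so $\widetilde\nabla_X\vec\xi=-dx(AX)$, with $\widetilde\nabla$ the Levi-Civita connection of $N^5_s(c)$), $H=\frac14\varepsilon\,\mathrm{tr}A$ the mean curvature and $\vec H=H\vec\xi$ the mean curvature vector field. Suppose that $\Delta\vec H=\lambda\vec H$ for a real constant $\lambda$, where $\Delta=-\sum_{i=1}^4\varepsilon_i(\widetilde\nabla_{e_i}\widetilde\nabla_{e_i}-\widetilde\nabla_{\nabla_{e_i}e_i})$ for local orthonormal frames $\{e_i\}$ of $M^4_r$ with $\langle e_i,e_i\rangle=\varepsilon_i=\pm1$, and $\nabla$ is the Levi-Civita connection of $M^4_r$. Suppose also that at every point $M^4_r$ has exactly two distinct principal curvatures (complex eigenvalues of $A$) and that both are imaginary, i.e. non-real (hence they are complex conjugate). Then: - if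 $c\varepsilon\ge 0$, then $H=0$ on $M^4_r$; - if $c\varepsilon<0$ and $|\varepsilon\lambda|\ge -4c\varepsilon$, then $H=0$ on $M^4_r$; - if $c\varepsilon<0$ and $|\varepsilon\lambda|<-4c\varepsilon$, then either $H=0$ on $M^4_r$, or $H^2=\dfrac{\varepsilon\lambda-4c\varepsilon}{8}$ on $M^4_r$. -/

import Mathlib

set_option maxSynthPendingDepth 3

open scoped Manifold ContDiff

noncomputable section

/-! ### Pseudo-Riemannian calculus in coordinates

In this section a metric on (an open subset of) a finite-dimensional vector space is a field `G` of
symmetric bilinear forms, and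
`(G y).inverse : (E →L[ℝ] ℝ) →L[ℝ] E` is the index-raising map of a nondegenerate form `G y`. -/

namespace LocalGeometry

variable {E F : Type*} [NormedAddCommGroup E] [NormedSpace ℝ E]
  [NormedAddCommGroup F] [NormedSpace ℝ F]

/-- The functional of the Koszul formula for constant vector fields `u, v, w`:
`½ (∂_u G(v, w) + ∂_v G(u, w) - ∂_w G(u, v))`. -/
def koszul (G : F → F →L[ℝ] F →L[ℝ] ℝ) (y : F) :
    F →L[ℝ] F →L[ℝ] F →L[ℝ] ℝ :=
  let D : F →L[ℝ] F →L[ℝ] F →L[ℝ] ℝ := fderiv ℝ G y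
  let T : (F →L[ℝ] F →L[ℝ] ℝ) →L[ℝ] (F →L[ℝ] F →L[ℝ] ℝ) :=
    (ContinuousLinearMap.flipₗᵢ ℝ F F ℝ).toContinuousLinearEquiv
  (1 / 2 : ℝ) • (D + D.flip - T ∘L D.flip)

theorem koszul_apply (G : F → F →L[ℝ] F →L[ℝ] ℝ) (y u v w : F) :
    koszul G y u v w =
      1 / 2 * (fderiv ℝ G y u v w + fderiv ℝ G y v u w - fderiv ℝ G y w u v) := by
  simp [koszul]

/-- The Christoffel symbols of the Levi-Civita connection of `G`, as a bilinear map: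
`christoffel G y u v = ∇_u v` at `y`, for constant vector fields `u`, `v`. -/
def christoffel (G : F → F →L[ℝ] F →L[ℝ] ℝ) (y : F) :
    F →L[ℝ] F →L[ℝ] F :=
  (ContinuousLinearMap.compL ℝ F (F →L[ℝ] ℝ) F (G y).inverse) ∘L koszul G y

theorem christoffel_apply (G : F → F →L[ℝ] F →L[ℝ] ℝ) (y u v : F) :
    christoffel G y u v = (G y).inverse (koszul G y u v) := rfl

/-- The curvature tensor `R(u, v) w = ∇_u ∇_v w - ∇_v ∇_u w - ∇_[u, v] w` of `G`, evaluated on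
constant vector fields. -/
def curvature (G : F → F →L[ℝ] F →L[ℝ] ℝ) (y u v w : F) : F :=
  fderiv ℝ (fun z => christoffel G z v w) y u - fderiv ℝ (fun z => christoffel G z u w) y v
    + christoffel G y u (christoffel G y v w) - christoffel G y v (christoffel G y u w)

/-- The metric induced by `G` through the map `f`. -/
def pullbackMetric (G : F → F →L[ℝ] F →L[ℝ] ℝ) (f : E → F) :
    E → E →L[ℝ] E →L[ℝ] ℝ :=
  fun y => (G (f y)).bilinearComp (fderiv ℝ f y) (fderiv ℝ f y)

/-- The covariant derivative, for the Levi-Civita connection of `G`, of a vector field `s` along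
the map `f`: `u ↦ ∂_u s + Γ(df(u), s)`. -/
def covDerivAlong (G : F → F →L[ℝ] F →L[ℝ] ℝ) (f s : E → F)
    (y : E) : E →L[ℝ] F :=
  fderiv ℝ s y + (christoffel G (f y)).flip (s y) ∘L fderiv ℝ f y

/-- The shape operator of the immersion `f` associated to the normal field `ν`:
`⟨A u, v⟩ = -⟨∇̃_u ν, df(v)⟩` for the induced metric, so that `-df(A u)` is the tangential
part of `∇̃_u ν`. -/
def shapeOp (G : F → F →L[ℝ] F →L[ℝ] ℝ) (f ν : E → F)
    (y : E) : E →L[ℝ] E :=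
  (pullbackMetric G f y).inverse ∘L
    (-(G (f y)).bilinearComp (covDerivAlong G f ν y) (fderiv ℝ f y))

/-- The coordinate space `ℝⁿ`. -/
abbrev Coord (n : ℕ) : Type := EuclideanSpace ℝ (Fin n)

variable {m n : ℕ}

/-- The entries `h^{ij}` of the inverse of the matrix of a nondegenerate symmetric form `h`. -/
def invEntry (h : Coord m →L[ℝ] Coord m →L[ℝ] ℝ) (i j : Fin m) : ℝ :=
  h.inverse (EuclideanSpace.proj i) j

/-- The Laplacian of a vector field `s` along the immersion `f`, with the sign convention
`Δ s = - ∑ h^{ij} (∇̃_i ∇̃_j s - ∇̃_{∇_i ∂_j} s)`, where `h` is the induced metric, `∇` its Levi-Civita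
connection and `∇̃` the Levi-Civita connection of `G`. -/
def laplacian (G : Coord n → Coord n →L[ℝ] Coord n →L[ℝ] ℝ) (f s : Coord m → Coord n)
    (y : Coord m) : Coord n :=
  -∑ i : Fin m, ∑ j : Fin m, invEntry (pullbackMetric G f y) i j •
    (covDerivAlong G f (fun z => covDerivAlong G f s z (EuclideanSpace.single j 1)) y
        (EuclideanSpace.single i 1)
      - covDerivAlong G f s y (christoffel (pullbackMetric G f) y
          (EuclideanSpace.single i 1) (EuclideanSpace.single j 1)))

end LocalGeometry

open LocalGeometry

/-! ### Pseudo-Riemannian manifolds -/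

section Manifolds

variable {m n : ℕ}
  {M : Type*} [TopologicalSpace M] [ChartedSpace (EuclideanSpace ℝ (Fin m)) M]
  {N : Type*} [TopologicalSpace N] [ChartedSpace (EuclideanSpace ℝ (Fin n)) N]

/-- The coordinate expression, in the chart around `q₀`, of a field `B` of bilinear forms on the
tangent spaces of `N`; it is meaningful on the target of the chart. -/
def bilinInChart (B : ∀ q : N, TangentSpace (𝓡 n) q →L[ℝ] TangentSpace (𝓡 n) q →L[ℝ] ℝ)
    (q₀ : N) (z : Coord n) : Coord n →L[ℝ] Coord n →L[ℝ] ℝ :=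
  let b : Coord n →L[ℝ] Coord n →L[ℝ] ℝ := B ((extChartAt (𝓡 n) q₀).symm z)
  let L : Coord n →L[ℝ] Coord n := mfderiv (𝓡 n) (𝓡 n) (extChartAt (𝓡 n) q₀).symm z
  b.bilinearComp L L

variable (n N) in
/-- A smooth pseudo-Riemannian metric, of arbitrary signature. -/
structure PseudoRiemannianMetric where
  /-- The scalar product on each tangent space. -/
  inner : ∀ q : N, TangentSpace (𝓡 n) q →L[ℝ] TangentSpace (𝓡 n) q →L[ℝ] ℝ
  symm : ∀ (q : N) (u v : TangentSpace (𝓡 n) q), inner q u v = inner q v u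
  nondegenerate : ∀ (q : N) (u : TangentSpace (𝓡 n) q), (∀ v, inner q u v = 0) → u = 0
  smooth : ∀ q₀ : N, ContDiffOn ℝ ∞ (bilinInChart inner q₀) (extChartAt (𝓡 n) q₀).target

namespace PseudoRiemannianMetric

/-- The metric in the chart around `q₀`. -/
def inChart (g : PseudoRiemannianMetric n N) (q₀ : N) :
    Coord n → Coord n →L[ℝ] Coord n →L[ℝ] ℝ :=
  bilinInChart g.inner q₀

/-- The sectional curvature `⟨R(u, v) v, u⟩ / (⟨u, u⟩ ⟨v, v⟩ - ⟨u, v⟩ ^ 2)` of every nondegenerate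
tangent plane is `c`. The condition is expressed in coordinates, in the charts of `N`. -/
def HasConstantSectionalCurvature (g : PseudoRiemannianMetric n N) (c : ℝ) : Prop :=
  ∀ q₀ : N, ∀ z ∈ (extChartAt (𝓡 n) q₀).target, ∀ u v : Coord n,
    let G := g.inChart q₀
    G z u u * G z v v - G z u v ^ 2 ≠ 0 →
      G z (curvature G z u v v) u / (G z u u * G z v v - G z u v ^ 2) = c

end PseudoRiemannianMetric

/-- The coordinate expression, near `p₀`, of a map `x : M → N`. -/
def mapInChart (x : M → N) (p₀ : M) : Coord m → Coord n :=
  fun y => extChartAt (𝓡 n) (x p₀) (x ((extChartAt (𝓡 m) p₀).symm y))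

/-- The coordinate expression, near `p₀`, of a vector field `s` along a map `x : M → N`. -/
def fieldInChart (x : M → N) (s : ∀ p : M, TangentSpace (𝓡 n) (x p)) (p₀ : M) :
    Coord m → Coord n :=
  fun y => mfderiv (𝓡 n) (𝓡 n) (extChartAt (𝓡 n) (x p₀)) (x ((extChartAt (𝓡 m) p₀).symm y))
    (s ((extChartAt (𝓡 m) p₀).symm y))

variable (m) in
/-- `x : M → N` is a smooth immersion whose induced metric is nondegenerate. -/
structure IsNondegenerateImmersion (g : PseudoRiemannianMetric n N) (x : M → N) : Prop where
  smooth : ContMDiff (𝓡 m) (𝓡 n) ∞ x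
  immersion : ∀ p : M, Function.Injective (mfderiv (𝓡 m) (𝓡 n) x p)
  nondegenerate : ∀ (p : M) (u : TangentSpace (𝓡 m) p),
    (∀ v : TangentSpace (𝓡 m) p,
      g.inner (x p) (mfderiv (𝓡 m) (𝓡 n) x p u) (mfderiv (𝓡 m) (𝓡 n) x p v) = 0) → u = 0

variable (m) in
/-- `ξ` is a smooth unit normal field along `x`, with `⟨ξ, ξ⟩ = ε = ±1`. -/
structure IsUnitNormal [IsManifold (𝓡 n) ∞ N] (g : PseudoRiemannianMetric n N) (x : M → N)
    (ξ : ∀ p : M, TangentSpace (𝓡 n) (x p)) (ε : ℝ) : Prop where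
  smooth : ContMDiff (𝓡 m) (𝓡 n).tangent ∞ (fun p => (⟨x p, ξ p⟩ : TangentBundle (𝓡 n) N))
  normal : ∀ (p : M) (u : TangentSpace (𝓡 m) p),
    g.inner (x p) (ξ p) (mfderiv (𝓡 m) (𝓡 n) x p u) = 0
  inner_self : ∀ p : M, g.inner (x p) (ξ p) (ξ p) = ε
  sign : ε = 1 ∨ ε = -1

/-- The shape operator of `x` at `p` associated to `ξ`, computed in the charts around
`p` and `x p` (whose coordinate vectors are Mathlib's tangent vectors at `p` and `x p`). -/
def shapeOperator (g : PseudoRiemannianMetric n N) (x : M → N)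
    (ξ : ∀ p : M, TangentSpace (𝓡 n) (x p)) (p : M) :
    TangentSpace (𝓡 m) p →L[ℝ] TangentSpace (𝓡 m) p :=
  shapeOp (g.inChart (x p)) (mapInChart x p) (fieldInChart x ξ p) (extChartAt (𝓡 m) p p)

variable (m) in
/-- The principal curvatures at `p`: the real and complex eigenvalues of the shape operator,
i.e. the complex roots of its characteristic polynomial. -/
def principalCurvatures (g : PseudoRiemannianMetric n N) (x : M → N)
    (ξ : ∀ p : M, TangentSpace (𝓡 n) (x p)) (p : M) : Set ℂ :=
  let A : Coord m →ₗ[ℝ] Coord m := (shapeOperator (m := m) g x ξ p).toLinearMap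
  {μ | (A.charpoly.map (algebraMap ℝ ℂ)).IsRoot μ}

variable (m) in
/-- The mean curvature `H = (1 / m) ε tr A`, where `ε = ⟨ξ, ξ⟩`. -/
def meanCurvature (g : PseudoRiemannianMetric n N) (x : M → N)
    (ξ : ∀ p : M, TangentSpace (𝓡 n) (x p)) (p : M) : ℝ :=
  let A : Coord m →ₗ[ℝ] Coord m := (shapeOperator (m := m) g x ξ p).toLinearMap
  1 / (m : ℝ) * g.inner (x p) (ξ p) (ξ p) * LinearMap.trace ℝ (Coord m) A

variable (m) in
/-- The mean curvature vector field `H ξ`. -/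
def meanCurvatureVector (g : PseudoRiemannianMetric n N) (x : M → N)
    (ξ : ∀ p : M, TangentSpace (𝓡 n) (x p)) (p : M) : TangentSpace (𝓡 n) (x p) :=
  meanCurvature m g x ξ p • ξ p

variable (m) in
/-- The Laplacian `Δ s = - ∑ εᵢ (∇̃_{eᵢ} ∇̃_{eᵢ} s - ∇̃_{∇_{eᵢ} eᵢ} s)` of a vector field `s` along `x`,
at the point `p`, computed in the charts around `p` and `x p`. -/
def laplacianAlong (g : PseudoRiemannianMetric n N) (x : M → N)
    (s : ∀ p : M, TangentSpace (𝓡 n) (x p)) (p : M) : TangentSpace (𝓡 n) (x p) :=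
  laplacian (g.inChart (x p)) (mapInChart x p) (fieldInChart x s p) (extChartAt (𝓡 m) p p)

variable (m) in
/-- The mean curvature vector field is proper with constant `lam`: `Δ H⃗ = lam H⃗`. -/
def HasProperMeanCurvature (g : PseudoRiemannianMetric n N) (x : M → N)
    (ξ : ∀ p : M, TangentSpace (𝓡 n) (x p)) (lam : ℝ) : Prop :=
  ∀ p : M, laplacianAlong m g x (meanCurvatureVector m g x ξ) p = lam • meanCurvatureVector m g x ξ p

end Manifolds

end

/-! The principal curvatures are a conjugate pair α ± iβ with β ≠ 0, so at each point the real
quartic characteristic polynomial of A is ((X - α)² + β²)². Hence tr A = 4α, that is α = εH, and tr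
A² = 4(α² - β²).

By Codazzi the divergence of A is d(tr A), so the tangential part of ΔH⃗ = λH⃗ reads dH(Aw + 2εHw) =
0 for all w. Since A has no real eigenvalue, A + 2εH is onto and dH = 0; connectedness makes H
constant (`fderiv_meanCurvature_eq_zero`, `meanCurvature_eq_of_properMeanCurvature`). If H ≠ 0, the
normal part is tr A² = ελ (`trace_sq_shapeOp`), so α and β² are constant too.

The core is Cartan's identity c + ε(α² + β²) = 0 (`cartan_identity`). Put K = (A - α)/β, a
self-adjoint Codazzi field, S = K² + 1, which satisfies S² = 0, and T = ∇K. If S vanishes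
identically, the symmetries of T force T = 0 (`eq_zero_of_codazzi`). Otherwise, near a point where S
≠ 0, every T_x with x in ker S commutes with K, and products of two such operators vanish
(`commute_of_codazzi`); differentiating [K, T_{Sa}] = 0 along ker S shows that second covariant
derivatives of K in directions of ker S commute with K. Either way the Ricci identity yields n ≠ 0
with K²n = -n such that [R(n, Kn), K] commutes with K (`exists_curvature_double_commutator`). By the
Gauss equation R(n, Kn) is c + ε(α² + β²) times w ↦ ⟨Kn, w⟩n - ⟨n, w⟩Kn. That operator anticommutes
with K, and its double commutator with K is -4 times itself, so the factor is zero
(`eq_zero_of_double_commutator`).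

Thus H ≠ 0 at one point gives cε = -(α² + β²) and ελ = 4(α² - β²) with α² = H² > 0 and β² > 0. This
forces cε < 0 and |ελ| < -4cε, and solving for α² gives the stated value of H².

The computations are local, in charts. Invariance of the shape operator under isometries and
reparametrizations (`fderiv_shapeOp_of_isometry`) lets pointwise data from different charts be
compared. -/

noncomputable section

open LocalGeometry

namespace LocalGeometry

variable {E F : Type*} [NormedAddCommGroup E] [NormedSpace ℝ E]
  [NormedAddCommGroup F] [NormedSpace ℝ F]

/-! ### Metrics on open subsets of a vector space -/

/-- `G` restricts to a smooth pseudo-Riemannian metric on the open set `V`. -/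
structure IsLocalMetric (G : F → F →L[ℝ] F →L[ℝ] ℝ) (V : Set F) : Prop where
  isOpen : IsOpen V
  contDiffAt : ∀ z ∈ V, ContDiffAt ℝ ∞ G z
  symm : ∀ z ∈ V, ∀ u v, G z u v = G z v u
  nondegenerate : ∀ z ∈ V, ∀ u, (∀ v, G z u v = 0) → u = 0

/-- `ContinuousLinearMap.inverse` takes the value 0 on non-invertible maps; this lemma guarantees
that index raising is genuine. It is an equality of dimensions. -/
theorem isInvertible_of_nondegenerate [FiniteDimensional ℝ F] {b : F →L[ℝ] F →L[ℝ] ℝ}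
    (hb : ∀ u, (∀ v, b u v = 0) → u = 0) : b.IsInvertible := by
  have hinj : Function.Injective b := by
    rw [injective_iff_map_eq_zero]
    intro u hu
    exact hb u fun v => by simp [hu]
  have hdim : Module.finrank ℝ F = Module.finrank ℝ (F →L[ℝ] ℝ) := by
    rw [← (LinearMap.toContinuousLinearMap (𝕜 := ℝ) (E := F) (F' := ℝ)).finrank_eq]
    exact (Subspace.dual_finrank_eq (K := ℝ) (V := F)).symm
  have : FiniteDimensional ℝ (F →L[ℝ] ℝ) :=
    (LinearMap.toContinuousLinearMap (𝕜 := ℝ) (E := F) (F' := ℝ)).finiteDimensional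
  exact ⟨(LinearEquiv.ofInjectiveOfFinrankEq b.toLinearMap hinj hdim).toContinuousLinearEquiv,
    by ext; rfl⟩

theorem fderiv_fderiv_comm {f : E → F} {y : E} (hf : ContDiffAt ℝ ∞ f y) (u v : E) :
    fderiv ℝ (fderiv ℝ f) y u v = fderiv ℝ (fderiv ℝ f) y v u :=
  (hf.isSymmSndFDerivAt (by simpa using ENat.LEInfty.out)).eq u v

theorem contDiffAt_fderiv {f : E → F} {y : E} (hf : ContDiffAt ℝ ∞ f y) :
    ContDiffAt ℝ ∞ (fderiv ℝ f) y :=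
  hf.fderiv_right (by simp)

theorem fderiv_clm_apply_const {H : Type*} [NormedAddCommGroup H] [NormedSpace ℝ H]
    {B : E → F →L[ℝ] H} {y : E} (hB : DifferentiableAt ℝ B y) (w : E) (u : F) :
    fderiv ℝ (fun z => B z u) y w = fderiv ℝ B y w u := by
  rw [fderiv_clm_apply hB (by fun_prop)]
  simp

theorem fderiv_clm_apply₂_const {H K : Type*} [NormedAddCommGroup H] [NormedSpace ℝ H]
    [NormedAddCommGroup K] [NormedSpace ℝ K]
    {B : E → F →L[ℝ] H →L[ℝ] K} {y : E} (hB : DifferentiableAt ℝ B y) (w : E) (u : F) (v : H) :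
    fderiv ℝ (fun z => B z u v) y w = fderiv ℝ B y w u v := by
  rw [fderiv_clm_apply_const (B := fun z => B z u) (by fun_prop), fderiv_clm_apply_const hB]

/-- The derivative of `B (f y) (s y) (t y)` for a field `B` of bilinear maps. -/
theorem fderiv_bilin_comp {H K : Type*} [NormedAddCommGroup H] [NormedSpace ℝ H]
    [NormedAddCommGroup K] [NormedSpace ℝ K] {B : F → F →L[ℝ] H →L[ℝ] K} {f s : E → F} {t : E → H}
    {y : E} (hB : DifferentiableAt ℝ B (f y)) (hf : DifferentiableAt ℝ f y)
    (hs : DifferentiableAt ℝ s y) (ht : DifferentiableAt ℝ t y) (w : E) :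
    fderiv ℝ (fun z => B (f z) (s z) (t z)) y w =
      fderiv ℝ B (f y) (fderiv ℝ f y w) (s y) (t y) + B (f y) (fderiv ℝ s y w) (t y)
        + B (f y) (s y) (fderiv ℝ t y w) := by
  have h1 : HasFDerivAt (fun z => B (f z)) (fderiv ℝ B (f y) ∘L fderiv ℝ f y) y :=
    hB.hasFDerivAt.comp y hf.hasFDerivAt
  have h2 := (h1.clm_apply hs.hasFDerivAt).clm_apply ht.hasFDerivAt
  rw [h2.fderiv]
  simp
  abel

namespace IsLocalMetric

variable {G : F → F →L[ℝ] F →L[ℝ] ℝ} {V : Set F}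

theorem mem_nhds (hG : IsLocalMetric G V) {z : F} (hz : z ∈ V) : V ∈ nhds z :=
  hG.isOpen.mem_nhds hz

theorem differentiableAt (hG : IsLocalMetric G V) {z : F} (hz : z ∈ V) :
    DifferentiableAt ℝ G z := (hG.contDiffAt z hz).differentiableAt (by simp)

theorem isInvertible [FiniteDimensional ℝ F] (hG : IsLocalMetric G V) {z : F} (hz : z ∈ V) :
    (G z).IsInvertible :=
  isInvertible_of_nondegenerate (hG.nondegenerate z hz)

theorem ext_inner (hG : IsLocalMetric G V) {z : F} (hz : z ∈ V) {u v : F}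
    (h : ∀ w, G z u w = G z v w) : u = v := by
  rw [← sub_eq_zero]
  exact hG.nondegenerate z hz _ fun w => by simp [h w]

theorem inner_christoffel [FiniteDimensional ℝ F] (hG : IsLocalMetric G V) {z : F} (hz : z ∈ V)
    (u v w : F) : G z (christoffel G z u v) w = koszul G z u v w := by
  rw [christoffel_apply, (hG.isInvertible hz).self_apply_inverse]

theorem fderiv_symm (hG : IsLocalMetric G V) {z : F} (hz : z ∈ V) (u v w : F) :
    fderiv ℝ G z u v w = fderiv ℝ G z u w v := by
  rw [← fderiv_clm_apply₂_const (hG.differentiableAt hz),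
    ← fderiv_clm_apply₂_const (hG.differentiableAt hz)]
  congr 1
  apply Filter.EventuallyEq.fderiv_eq
  filter_upwards [hG.mem_nhds hz] with y hy using hG.symm y hy v w

theorem christoffel_symm [FiniteDimensional ℝ F] (hG : IsLocalMetric G V) {z : F} (hz : z ∈ V)
    (u v : F) : christoffel G z u v = christoffel G z v u := by
  apply hG.ext_inner hz
  intro w
  rw [hG.inner_christoffel hz, hG.inner_christoffel hz, koszul_apply, koszul_apply,
    hG.fderiv_symm hz w u v]
  ring

/-- Metric compatibility, ∇G = 0: adding the Koszul functional with its last two arguments exchanged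
cancels all but one derivative of `G`. -/
theorem fderiv_eq [FiniteDimensional ℝ F] (hG : IsLocalMetric G V) {z : F} (hz : z ∈ V)
    (u v w : F) : fderiv ℝ G z u v w =
      G z (christoffel G z u v) w + G z v (christoffel G z u w) := by
  rw [hG.symm z hz v, hG.inner_christoffel hz, hG.inner_christoffel hz, koszul_apply,
    koszul_apply, hG.fderiv_symm hz u w v]
  ring

theorem contDiffAt_koszul (hG : IsLocalMetric G V) {z : F} (hz : z ∈ V) :
    ContDiffAt ℝ ∞ (koszul G) z := by
  have h := contDiffAt_fderiv (hG.contDiffAt z hz)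
  unfold koszul
  have hflip : ContDiff ℝ ∞
      (fun D : F →L[ℝ] F →L[ℝ] F →L[ℝ] ℝ => D.flip) :=
    (ContinuousLinearMap.flipₗᵢ ℝ F F (F →L[ℝ] ℝ)).toContinuousLinearEquiv.contDiff
  have h2 := hflip.contDiffAt.comp z h
  exact ContDiffAt.const_smul _ ((h.add h2).sub (ContDiffAt.clm_comp contDiffAt_const h2))

theorem contDiffAt_inverse [FiniteDimensional ℝ F] (hG : IsLocalMetric G V) {z : F} (hz : z ∈ V) :
    ContDiffAt ℝ ∞ (fun y => (G y).inverse) z := by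
  have := FiniteDimensional.complete ℝ F
  exact ((hG.isInvertible hz).contDiffAt_map_inverse).comp z (hG.contDiffAt z hz)

theorem contDiffAt_christoffel [FiniteDimensional ℝ F] (hG : IsLocalMetric G V) {z : F}
    (hz : z ∈ V) : ContDiffAt ℝ ∞ (christoffel G) z := by
  unfold christoffel
  refine ContDiffAt.clm_comp ?_ (hG.contDiffAt_koszul hz)
  exact (ContinuousLinearMap.compL ℝ F (F →L[ℝ] ℝ) F).contDiff.contDiffAt.comp z
    (hG.contDiffAt_inverse hz)

theorem differentiableAt_christoffel [FiniteDimensional ℝ F] (hG : IsLocalMetric G V) {z : F}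
    (hz : z ∈ V) : DifferentiableAt ℝ (christoffel G) z :=
  (hG.contDiffAt_christoffel hz).differentiableAt (by simp)

end IsLocalMetric

/-! ### Vector fields along maps -/

variable {G : F → F →L[ℝ] F →L[ℝ] ℝ} {V : Set F}

theorem covDerivAlong_apply (G : F → F →L[ℝ] F →L[ℝ] ℝ) (f s : E → F) (y u : E) :
    covDerivAlong G f s y u =
      fderiv ℝ s y u + christoffel G (f y) (fderiv ℝ f y u) (s y) := rfl

theorem pullbackMetric_apply (G : F → F →L[ℝ] F →L[ℝ] ℝ) (f : E → F) (y u v : E) :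
    pullbackMetric G f y u v = G (f y) (fderiv ℝ f y u) (fderiv ℝ f y v) := rfl

theorem contDiffAt_pullbackMetric {f : E → F} {y : E} (hG : ContDiffAt ℝ ∞ G (f y))
    (hf : ContDiffAt ℝ ∞ f y) : ContDiffAt ℝ ∞ (pullbackMetric G f) y := by
  have h1 : ContDiffAt ℝ ∞ (fun z => G (f z)) y := hG.comp y hf
  have h2 := contDiffAt_fderiv hf
  have hflip : ContDiff ℝ ∞ (fun D : E →L[ℝ] E →L[ℝ] ℝ => D.flip) :=
    (ContinuousLinearMap.flipₗᵢ ℝ E E ℝ).toContinuousLinearEquiv.contDiff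
  have hflip' : ContDiff ℝ ∞ (fun D : E →L[ℝ] F →L[ℝ] ℝ => D.flip) :=
    (ContinuousLinearMap.flipₗᵢ ℝ E F ℝ).toContinuousLinearEquiv.contDiff
  exact hflip.contDiffAt.comp y
    ((hflip'.contDiffAt.comp y (h1.clm_comp h2)).clm_comp h2)

/-- The Christoffel functional of a pulled back metric. -/
theorem koszul_pullbackMetric {f : E → F} {y : E} (hG : IsLocalMetric G V) (hy : f y ∈ V)
    (hf : ContDiffAt ℝ ∞ f y) (u v w : E) :
    koszul (pullbackMetric G f) y u v w =
      koszul G (f y) (fderiv ℝ f y u) (fderiv ℝ f y v) (fderiv ℝ f y w)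
        + G (f y) (fderiv ℝ (fderiv ℝ f) y u v) (fderiv ℝ f y w) := by
  have hd : DifferentiableAt ℝ (fderiv ℝ f) y := (contDiffAt_fderiv hf).differentiableAt (by simp)
  have key : ∀ a b d : E, fderiv ℝ (pullbackMetric G f) y a b d =
      fderiv ℝ G (f y) (fderiv ℝ f y a) (fderiv ℝ f y b) (fderiv ℝ f y d)
        + G (f y) (fderiv ℝ (fderiv ℝ f) y a b) (fderiv ℝ f y d)
        + G (f y) (fderiv ℝ f y b) (fderiv ℝ (fderiv ℝ f) y a d) := by
    intro a b d
    rw [← fderiv_clm_apply₂_const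
      ((contDiffAt_pullbackMetric (hG.contDiffAt _ hy) hf).differentiableAt (by simp))]
    simp only [pullbackMetric_apply]
    rw [fderiv_bilin_comp (hG.differentiableAt hy) (hf.differentiableAt (by simp))
      (by fun_prop) (by fun_prop), fderiv_clm_apply_const hd, fderiv_clm_apply_const hd]
  -- Of the six terms with second derivatives of `f`, four cancel by symmetry and the remaining two
  -- are equal, which uses up the factor 1/2.
  rw [koszul_apply, koszul_apply, key, key, key, fderiv_fderiv_comm hf v u,
    fderiv_fderiv_comm hf w u, fderiv_fderiv_comm hf w v,
    hG.symm _ hy (fderiv ℝ f y v) (fderiv ℝ (fderiv ℝ f) y u w),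
    hG.symm _ hy (fderiv ℝ f y u) (fderiv ℝ (fderiv ℝ f) y v w)]
  ring

theorem fderiv_inner_along [FiniteDimensional ℝ F] {f s t : E → F} {y : E}
    (hG : IsLocalMetric G V) (hy : f y ∈ V) (hf : DifferentiableAt ℝ f y)
    (hs : DifferentiableAt ℝ s y) (ht : DifferentiableAt ℝ t y) (u : E) :
    fderiv ℝ (fun z => G (f z) (s z) (t z)) y u =
      G (f y) (covDerivAlong G f s y u) (t y) + G (f y) (s y) (covDerivAlong G f t y u) := by
  rw [fderiv_bilin_comp (hG.differentiableAt hy) hf hs ht, hG.fderiv_eq hy]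
  simp only [covDerivAlong_apply, map_add, add_apply]
  ring

theorem contDiffAt_covDerivAlong [FiniteDimensional ℝ F] {f s : E → F} {y : E}
    (hG : IsLocalMetric G V) (hy : f y ∈ V) (hf : ContDiffAt ℝ ∞ f y) (hs : ContDiffAt ℝ ∞ s y)
    (v : E) : ContDiffAt ℝ ∞ (fun z => covDerivAlong G f s z v) y := by
  simp only [covDerivAlong_apply]
  have h1 := contDiffAt_fderiv hs
  have h2 := contDiffAt_fderiv hf
  have h3 : ContDiffAt ℝ ∞ (fun z => christoffel G (f z)) y :=
    (hG.contDiffAt_christoffel hy).comp y hf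
  exact (h1.clm_apply contDiffAt_const).add ((h3.clm_apply (h2.clm_apply contDiffAt_const)).clm_apply hs)

/-- Second covariant derivatives of a vector field along a map commute up to curvature. -/
theorem covDerivAlong_comm [FiniteDimensional ℝ F] {f s : E → F} {y : E}
    (hG : IsLocalMetric G V) (hy : f y ∈ V) (hf : ContDiffAt ℝ ∞ f y) (hs : ContDiffAt ℝ ∞ s y)
    (u v : E) :
    covDerivAlong G f (fun z => covDerivAlong G f s z v) y u
      - covDerivAlong G f (fun z => covDerivAlong G f s z u) y v =
    curvature G (f y) (fderiv ℝ f y u) (fderiv ℝ f y v) (s y) := by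
  have hd : DifferentiableAt ℝ (fderiv ℝ f) y := (contDiffAt_fderiv hf).differentiableAt (by simp)
  have hds : DifferentiableAt ℝ (fderiv ℝ s) y := (contDiffAt_fderiv hs).differentiableAt (by simp)
  have hΓ := hG.differentiableAt_christoffel hy
  have hf' := hf.differentiableAt (by simp)
  have hs' := hs.differentiableAt (by simp)
  have key : ∀ a b : E, covDerivAlong G f (fun z => covDerivAlong G f s z b) y a =
      fderiv ℝ (fderiv ℝ s) y a b
        + (fderiv ℝ (christoffel G) (f y) (fderiv ℝ f y a) (fderiv ℝ f y b) (s y)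
          + christoffel G (f y) (fderiv ℝ (fderiv ℝ f) y a b) (s y)
          + christoffel G (f y) (fderiv ℝ f y b) (fderiv ℝ s y a))
        + christoffel G (f y) (fderiv ℝ f y a) (fderiv ℝ s y b
          + christoffel G (f y) (fderiv ℝ f y b) (s y)) := by
    intro a b
    have h1 : DifferentiableAt ℝ (fun z => christoffel G (f z) (fderiv ℝ f z b) (s z)) y := by
      have : DifferentiableAt ℝ (fun z => christoffel G (f z)) y := hΓ.comp y hf'
      fun_prop
    simp only [covDerivAlong_apply]
    rw [fderiv_fun_add (by fun_prop) h1, add_apply,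
      fderiv_clm_apply_const hds, fderiv_bilin_comp hΓ hf' (by fun_prop) hs',
      fderiv_clm_apply_const hd]
  rw [key, key, curvature, fderiv_clm_apply₂_const hΓ, fderiv_clm_apply₂_const hΓ,
    fderiv_fderiv_comm hf u v, fderiv_fderiv_comm hs u v, map_add, map_add]
  abel

/-! ### Curvature -/

/-- A quadrilinear form with the symmetries of a curvature tensor vanishes if all its sectional
curvatures do. -/
theorem eq_zero_of_sectional_eq_zero {F : Type*} [AddCommGroup F] {Q : F → F → F → F → ℝ}
    (add₁ : ∀ u u' v w z, Q (u + u') v w z = Q u v w z + Q u' v w z)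
    (add₂ : ∀ u v v' w z, Q u (v + v') w z = Q u v w z + Q u v' w z)
    (add₃ : ∀ u v w w' z, Q u v (w + w') z = Q u v w z + Q u v w' z)
    (add₄ : ∀ u v w z z', Q u v w (z + z') = Q u v w z + Q u v w z')
    (anti : ∀ u v w z, Q u v w z = -Q v u w z) (self : ∀ u v w, Q u v w w = 0)
    (bianchi : ∀ u v w z, Q u v w z + Q v w u z + Q w u v z = 0)
    (sec : ∀ u v, Q u v v u = 0) (u v w z : F) : Q u v w z = 0 := by
  have anti' : ∀ u v w z, Q u v w z = -Q u v z w := by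
    intro u v w z
    have h := self u v (w + z)
    rw [add₃, add₄, add₄, self, self] at h
    linarith
  -- Pair symmetry from the four Bianchi identities on the faces of the usual octahedron.
  have pair : ∀ u v w z, Q u v w z = Q w z u v := by
    intro u v w z
    linarith [bianchi u v w z, bianchi v w z u, bianchi w z u v, bianchi z u v w,
      anti u v w z, anti v w u z, anti w u v z, anti v w z u, anti w z v u, anti z v w u,
      anti w z u v, anti z u w v, anti u w z v, anti z u v w, anti u v z w, anti v z u w,
      anti' u v w z, anti' v w u z, anti' w u v z, anti' v w z u, anti' w z v u, anti' z v w u,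
      anti' w z u v, anti' z u w v, anti' u w z v, anti' z u v w, anti' u v z w, anti' v z u w]
  -- Polarization of `sec` in its second argument; `anti''` polarizes again in the first.
  have hz : ∀ u v w, Q u v w u = 0 := by
    intro u v w
    have h := sec u (v + w)
    rw [add₂, add₃, add₃, sec, sec] at h
    linarith [pair u w v u, anti v u u w, anti' u v u w]
  have anti'' : ∀ u v w z, Q u v w z = -Q z v w u := by
    intro u v w z
    have h := hz (u + z) v w
    rw [add₁, add₄, add₄, hz, hz] at h
    linarith
  have swap₁₃ : ∀ u v w z, Q u v w z = -Q w v u z := by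
    intro u v w z
    linarith [anti'' u v w z, anti' z v w u, anti'' z v u w]
  -- `Q` is now alternating in its first three arguments, so its three cyclic terms agree and
  -- Bianchi reads 3Q = 0.
  linarith [bianchi u v w z, anti u v w z, swap₁₃ v u w z, swap₁₃ v w u z, anti u w v z,
    swap₁₃ u v w z, anti w v u z]

variable {F : Type*} [NormedAddCommGroup F] [NormedSpace ℝ F]
  {G : F → F →L[ℝ] F →L[ℝ] ℝ} {V : Set F}

theorem curvature_antisymm (G : F → F →L[ℝ] F →L[ℝ] ℝ) (z u v w : F) :
    curvature G z u v w = -curvature G z v u w := by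
  simp only [curvature]; abel

namespace IsLocalMetric

variable [FiniteDimensional ℝ F] (hG : IsLocalMetric G V) {z : F} (hz : z ∈ V)

include hG hz

theorem curvature_eq (u v w : F) : curvature G z u v w =
    fderiv ℝ (christoffel G) z u v w - fderiv ℝ (christoffel G) z v u w
      + christoffel G z u (christoffel G z v w) - christoffel G z v (christoffel G z u w) := by
  rw [curvature, fderiv_clm_apply₂_const (hG.differentiableAt_christoffel hz),
    fderiv_clm_apply₂_const (hG.differentiableAt_christoffel hz)]

theorem fderiv_christoffel_symm (u v w : F) :
    fderiv ℝ (christoffel G) z u v w = fderiv ℝ (christoffel G) z u w v := by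
  rw [← fderiv_clm_apply₂_const (hG.differentiableAt_christoffel hz),
    ← fderiv_clm_apply₂_const (hG.differentiableAt_christoffel hz)]
  congr 1
  apply Filter.EventuallyEq.fderiv_eq
  filter_upwards [hG.mem_nhds hz] with y hy using hG.christoffel_symm hy v w

theorem curvature_bianchi (u v w : F) :
    curvature G z u v w + curvature G z v w u + curvature G z w u v = 0 := by
  simp only [hG.curvature_eq hz]
  rw [hG.fderiv_christoffel_symm hz u w v, hG.fderiv_christoffel_symm hz v w u,
    hG.fderiv_christoffel_symm hz w v u, hG.christoffel_symm hz w u, hG.christoffel_symm hz v u,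
    hG.christoffel_symm hz w v]
  abel

/-- The Hessian of the function `G y w w` is symmetric; antisymmetrizing its expression by covariant
derivatives leaves twice ⟨R(u, v)w, w⟩. -/
theorem inner_curvature_self (u v w : F) : G z (curvature G z u v w) w = 0 := by
  have hid : ∀ y : F, ContDiffAt ℝ ∞ (fun y : F => y) y := fun y => contDiffAt_id
  have hw : ∀ y : F, ContDiffAt ℝ ∞ (fun _ : F => w) y := fun y => contDiffAt_const
  have hb : ContDiffAt ℝ ∞ (fun y => G y w w) z :=
    ((hG.contDiffAt z hz).clm_apply contDiffAt_const).clm_apply contDiffAt_const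
  have first : ∀ v, (fun y => fderiv ℝ (fun y => G y w w) y v) =ᶠ[nhds z]
      fun y => 2 * G y (covDerivAlong G (fun y => y) (fun _ => w) y v) w := by
    intro v
    filter_upwards [hG.mem_nhds hz] with y hy
    have := fderiv_inner_along (f := fun y => y) (s := fun _ => w) (t := fun _ => w)
      (y := y) hG hy (by fun_prop) (by fun_prop) (by fun_prop) v
    rw [this, hG.symm y hy w]
    ring
  have second : ∀ u v, fderiv ℝ (fderiv ℝ (fun y => G y w w)) z u v =
      2 * (G z (covDerivAlong G (fun y => y) (fun y => covDerivAlong G (fun y => y)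
        (fun _ => w) y v) z u) w + G z (covDerivAlong G (fun y => y) (fun _ => w) z v)
          (covDerivAlong G (fun y => y) (fun _ => w) z u)) := by
    intro u v
    have hs := contDiffAt_covDerivAlong (f := fun y => y) (s := fun _ => w) hG hz (hid z) (hw z) v
    rw [← fderiv_clm_apply_const ((contDiffAt_fderiv hb).differentiableAt (by simp)),
      (first v).fderiv_eq]
    have hd : DifferentiableAt ℝ
        (fun y => G y (covDerivAlong G (fun y => y) (fun _ => w) y v) w) z :=
      ((hG.differentiableAt hz).clm_apply (hs.differentiableAt (by simp))).clm_apply (by fun_prop)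
    rw [fderiv_const_mul hd, smul_apply, smul_eq_mul,
      fderiv_inner_along (f := fun y => y) hG hz (by fun_prop)
        (hs.differentiableAt (by simp)) (by fun_prop)]
  have hcomm := covDerivAlong_comm (f := fun y => y) (s := fun _ => w) hG hz (hid z) (hw z) u v
  have h := fderiv_fderiv_comm hb u v
  rw [second, second, hG.symm z hz (covDerivAlong G (fun y => y) (fun _ => w) z u)] at h
  simp only [fderiv_fun_id, ContinuousLinearMap.coe_id', id_eq] at hcomm
  rw [← hcomm, map_sub, sub_apply]
  linarith

omit [FiniteDimensional ℝ F] in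
/-- Every nonzero vector lies in a nondegenerate plane. -/
theorem exists_nondegenerate_plane (hdim : 2 ≤ Module.finrank ℝ F) {v : F} (hv : v ≠ 0) :
    ∃ a, G z a a * G z v v - G z a v ^ 2 ≠ 0 := by
  by_contra! h
  by_cases hvv : G z v v = 0
  · refine hv (hG.nondegenerate z hz v fun a => ?_)
    have := h a
    rw [hvv, mul_zero, zero_sub, neg_eq_zero, sq_eq_zero_iff] at this
    rw [hG.symm z hz, this]
  · obtain ⟨w, hw⟩ : ∃ w, w ∉ Submodule.span ℝ {v} := by
      by_contra! hall
      have : Submodule.span ℝ {v} = ⊤ := by ext w; simp [hall w]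
      have h1 := finrank_span_singleton (K := ℝ) hv
      rw [this, finrank_top] at h1
      omega
    -- The component of `w` orthogonal to `v`, nonzero because `w` is not a multiple of `v`.
    set a := w - (G z w v / G z v v) • v with ha
    have hav : G z a v = 0 := by
      simp [ha]; field_simp; ring
    -- The quadratic form ⟨b, b⟩⟨v, v⟩ - ⟨b, v⟩² vanishes identically, hence so does its
    -- polarization; pair it with `a`, which is orthogonal to `v`.
    have hpol : ∀ b, G z a b * G z v v = 0 := by
      intro b
      have h1 := h a
      have h2 := h b
      have h3 := h (a + b)
      simp only [map_add, add_apply, hav, hG.symm z hz b a] at h1 h2 h3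
      linarith
    have : a = 0 := hG.nondegenerate z hz a fun b => by simpa [hvv] using hpol b
    refine hw ?_
    rw [sub_eq_zero.1 (ha.symm.trans this)]
    exact Submodule.smul_mem _ _ (Submodule.mem_span_singleton_self v)

/-- The hypothesis says nothing about degenerate planes. These are reached along a line u + ta with
(a, v) spanning a nondegenerate plane: its Gram determinant is a nonzero polynomial in t, so the
identity holds for all but finitely many t and therefore at t = 0. The difference from the model
tensor then has zero sectional curvatures, and `eq_zero_of_sectional_eq_zero` applies. -/
theorem curvature_of_sectional (hdim : 2 ≤ Module.finrank ℝ F) {c : ℝ}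
    (h : ∀ u v, G z u u * G z v v - G z u v ^ 2 ≠ 0 →
      G z (curvature G z u v v) u / (G z u u * G z v v - G z u v ^ 2) = c) (u v w : F) :
    curvature G z u v w = c • (G z v w • u - G z u w • v) := by
  have sec : ∀ u v, G z (curvature G z u v v) u = c * (G z u u * G z v v - G z u v ^ 2) := by
    intro u v
    by_cases hv : v = 0
    · subst hv; simp [hG.curvature_eq hz]
    obtain ⟨a, ha⟩ := hG.exists_nondegenerate_plane hz hdim hv
    let B : F → F → ℝ := fun u u' =>
      G z (curvature G z u v v) u' - c * (G z u u' * G z v v - G z u v * G z u' v)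
    let C : F → F → ℝ := fun u u' => G z u u' * G z v v - G z u v * G z u' v
    have hB : ∀ t : ℝ, B (u + t • a) (u + t • a) = B u u + (B u a + B a u) * t + B a a * t ^ 2 := by
      intro t
      simp only [B, hG.curvature_eq hz, map_add, map_smul, map_sub, add_apply, sub_apply, smul_apply,
        smul_eq_mul]
      ring
    have hC : ∀ t : ℝ, C (u + t • a) (u + t • a) = C u u + (C u a + C a u) * t + C a a * t ^ 2 := by
      intro t
      simp only [C, map_add, map_smul, add_apply, smul_apply, smul_eq_mul]
      ring
    open Polynomial in
    let p : ℝ[X] := Polynomial.C (B u u) + Polynomial.C (B u a + B a u) * X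
      + Polynomial.C (B a a) * X ^ 2
    open Polynomial in
    let q : ℝ[X] := Polynomial.C (C u u) + Polynomial.C (C u a + C a u) * X
      + Polynomial.C (C a a) * X ^ 2
    -- Here `p` is the defect of the curvature identity along the line and `q` the Gram determinant;
    -- wherever `q` is nonzero, `p` vanishes.
    have hpq : p * q = 0 := by
      apply Polynomial.funext
      intro t
      have hp : p.eval t = B (u + t • a) (u + t • a) := by simp [p, hB]
      have hq : q.eval t = C (u + t • a) (u + t • a) := by simp [q, hC]
      rw [Polynomial.eval_mul, hp, hq, Polynomial.eval_zero, mul_eq_zero, or_iff_not_imp_right]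
      intro hne
      have h1 := h (u + t • a) v (by simpa [C, sq] using hne)
      rw [div_eq_iff (by simpa [C, sq] using hne)] at h1
      simp only [B, h1]
      ring
    have hq : q ≠ 0 := by
      intro h0
      have := congrArg (fun r => Polynomial.coeff r 2) h0
      simp [q] at this
      exact ha (by simpa [C, sq] using this)
    have hp : p = 0 := (mul_eq_zero.1 hpq).resolve_right hq
    have := congrArg (Polynomial.eval 0) hp
    simp [p, B] at this
    linarith
  apply hG.ext_inner hz
  intro x
  have := eq_zero_of_sectional_eq_zero
    (Q := fun u v w x => G z (curvature G z u v w) x - c * (G z v w * G z u x - G z u w * G z v x))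
    ?_ ?_ ?_ ?_ ?_ ?_ ?_ ?_ u v w x
  · simp only [map_sub, map_smul, sub_apply, smul_apply, smul_eq_mul]
    linarith
  · intros; simp only [hG.curvature_eq hz, map_add, map_sub, add_apply, sub_apply]; ring
  · intros; simp only [hG.curvature_eq hz, map_add, map_sub, add_apply, sub_apply]; ring
  · intros; simp only [hG.curvature_eq hz, map_add, map_sub, add_apply, sub_apply]; ring
  · intros; simp only [map_add]; ring
  · intro u v w x
    rw [curvature_antisymm G z u v w, map_neg, neg_apply]; ring
  · intro u v w
    rw [hG.inner_curvature_self hz]; ring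
  · intro u v w x
    have h := congrArg (fun r => G z r x) (hG.curvature_bianchi hz u v w)
    simp only [map_add, add_apply, map_zero, zero_apply] at h
    rw [hG.symm z hz v w, hG.symm z hz u w, hG.symm z hz u v]
    linarith
  · intro u v
    rw [sec, hG.symm z hz v u]; ring

end IsLocalMetric

variable {E F : Type*} [NormedAddCommGroup E] [NormedSpace ℝ E]
  [NormedAddCommGroup F] [NormedSpace ℝ F]
  {G : F → F →L[ℝ] F →L[ℝ] ℝ} {V : Set F} {f ν : E → F} {U : Set E} {ε : ℝ}

/-! ### Hypersurfaces in coordinates -/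

/-- `f` is a hypersurface of `(V, G)` parametrized by the open set `U`, with nondegenerate induced
metric and with unit normal field `ν` of causal character `ε`. -/
structure IsLocalHypersurface (G : F → F →L[ℝ] F →L[ℝ] ℝ) (V : Set F) (f ν : E → F) (U : Set E)
    (ε : ℝ) : Prop where
  metric : IsLocalMetric G V
  isOpen : IsOpen U
  mapsTo : Set.MapsTo f U V
  contDiffAt_map : ∀ y ∈ U, ContDiffAt ℝ ∞ f y
  contDiffAt_normal : ∀ y ∈ U, ContDiffAt ℝ ∞ ν y
  normal : ∀ y ∈ U, ∀ u, G (f y) (ν y) (fderiv ℝ f y u) = 0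
  inner_self : ∀ y ∈ U, G (f y) (ν y) (ν y) = ε
  sign : ε = 1 ∨ ε = -1
  nondegenerate : ∀ y ∈ U, ∀ u, (∀ v, pullbackMetric G f y u v = 0) → u = 0
  finrank_eq : Module.finrank ℝ F = Module.finrank ℝ E + 1

/-- The covariant derivative of a field of endomorphisms `A`, for the connection with Christoffel
symbols `Γ`. -/
def covDerivEnd (Γ : E → E →L[ℝ] E →L[ℝ] E) (A : E → E →L[ℝ] E) (y : E) :
    E →L[ℝ] E →L[ℝ] E :=
  fderiv ℝ A y + ContinuousLinearMap.postcomp E (A y) ∘L (-Γ y)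
    + ContinuousLinearMap.precomp E (A y) ∘L Γ y

theorem covDerivEnd_apply (Γ : E → E →L[ℝ] E →L[ℝ] E) (A : E → E →L[ℝ] E) (y u : E) :
    covDerivEnd Γ A y u = fderiv ℝ A y u + Γ y u * A y - A y * Γ y u := by
  ext v
  simp [covDerivEnd]
  abel

theorem contDiffAt_covDerivAlong' [FiniteDimensional ℝ F] {s : E → F} {y : E}
    (hG : IsLocalMetric G V) (hy : f y ∈ V) (hf : ContDiffAt ℝ ∞ f y) (hs : ContDiffAt ℝ ∞ s y) :
    ContDiffAt ℝ ∞ (covDerivAlong G f s) y := by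
  have h1 := contDiffAt_fderiv hs
  have h2 := contDiffAt_fderiv hf
  have h3 : ContDiffAt ℝ ∞ (fun z => christoffel G (f z)) y :=
    (hG.contDiffAt_christoffel hy).comp y hf
  have hflip : ContDiff ℝ ∞ (fun D : F →L[ℝ] F →L[ℝ] F => D.flip) :=
    (ContinuousLinearMap.flipₗᵢ ℝ F F F).toContinuousLinearEquiv.contDiff
  exact h1.add (((hflip.contDiffAt.comp y h3).clm_apply hs).clm_comp h2)

section CovDerivAlong

variable {s t : E → F} {y : E}

theorem covDerivAlong_congr (h : s =ᶠ[nhds y] t) :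
    covDerivAlong G f s y = covDerivAlong G f t y := by
  rw [covDerivAlong, covDerivAlong, h.fderiv_eq, h.eq_of_nhds]

theorem covDerivAlong_neg : covDerivAlong G f (fun z => -s z) y = -covDerivAlong G f s y := by
  ext u
  simp only [covDerivAlong_apply, fderiv_fun_neg, neg_apply, map_neg]
  abel

theorem covDerivAlong_add (hs : DifferentiableAt ℝ s y) (ht : DifferentiableAt ℝ t y) :
    covDerivAlong G f (fun z => s z + t z) y =
      covDerivAlong G f s y + covDerivAlong G f t y := by
  ext u
  simp only [covDerivAlong_apply, fderiv_fun_add hs ht, add_apply, map_add]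
  abel

theorem covDerivAlong_smul {φ : E → ℝ} (hφ : DifferentiableAt ℝ φ y) (hs : DifferentiableAt ℝ s y)
    (u : E) : covDerivAlong G f (fun z => φ z • s z) y u =
      fderiv ℝ φ y u • s y + φ y • covDerivAlong G f s y u := by
  simp only [covDerivAlong_apply, fderiv_fun_smul hφ hs, add_apply, map_smul, smul_add]
  simp
  abel

end CovDerivAlong

namespace IsLocalHypersurface

section

variable (hf : IsLocalHypersurface G V f ν U ε) {y : E} (hy : y ∈ U)

include hf in
theorem sign_mul_self : ε * ε = 1 := by
  rcases hf.sign with h | h <;> simp [h]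

include hf in
theorem sign_ne_zero : ε ≠ 0 := by
  rcases hf.sign with h | h <;> simp [h]

include hf in
theorem mem_nhds (hy : y ∈ U) : U ∈ nhds y :=
  hf.isOpen.mem_nhds hy

include hf in
theorem isLocalMetric_pullbackMetric : IsLocalMetric (pullbackMetric G f) U where
  isOpen := hf.isOpen
  contDiffAt y hy :=
    contDiffAt_pullbackMetric (hf.metric.contDiffAt _ (hf.mapsTo hy)) (hf.contDiffAt_map y hy)
  symm _ hy _ _ := hf.metric.symm _ (hf.mapsTo hy) _ _
  nondegenerate := hf.nondegenerate

include hf hy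

theorem differentiableAt_map : DifferentiableAt ℝ f y :=
  (hf.contDiffAt_map y hy).differentiableAt (by simp)

theorem differentiableAt_normal : DifferentiableAt ℝ ν y :=
  (hf.contDiffAt_normal y hy).differentiableAt (by simp)

theorem differentiableAt_fderiv : DifferentiableAt ℝ (fderiv ℝ f) y :=
  (contDiffAt_fderiv (hf.contDiffAt_map y hy)).differentiableAt (by simp)

theorem inner_fderiv_normal (u : E) : G (f y) (fderiv ℝ f y u) (ν y) = 0 := by
  rw [hf.metric.symm _ (hf.mapsTo hy), hf.normal y hy]

theorem fderiv_injective : Function.Injective (fderiv ℝ f y) := by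
  rw [injective_iff_map_eq_zero]
  intro v hv
  exact hf.nondegenerate y hy v fun w => by rw [pullbackMetric_apply, hv]; simp

theorem covDerivAlong_fderiv (u v : E) :
    covDerivAlong G f (fun z => fderiv ℝ f z v) y u =
      fderiv ℝ (fderiv ℝ f) y u v
        + christoffel G (f y) (fderiv ℝ f y u) (fderiv ℝ f y v) := by
  rw [covDerivAlong_apply, fderiv_clm_apply_const (hf.differentiableAt_fderiv hy)]

theorem inner_shapeOp [FiniteDimensional ℝ E] (u v : E) :
    pullbackMetric G f y (shapeOp G f ν y u) v =
      -G (f y) (covDerivAlong G f ν y u) (fderiv ℝ f y v) := by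
  have := (hf.isLocalMetric_pullbackMetric.isInvertible hy).self_apply_inverse
  simp [shapeOp, this]

variable [FiniteDimensional ℝ E] [FiniteDimensional ℝ F]

/-- By a dimension count, the image of df and the line of ν together fill the ambient space. -/
theorem eq_zero_of_inner {a : F} (h : ∀ w, G (f y) a (fderiv ℝ f y w) = 0)
    (hν : G (f y) a (ν y) = 0) : a = 0 := by
  let L : E × ℝ →ₗ[ℝ] F := (fderiv ℝ f y).toLinearMap.coprod (LinearMap.toSpanSingleton ℝ F (ν y))
  have hL : ∀ v t, L (v, t) = fderiv ℝ f y v + t • ν y := fun v t => by simp [L]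
  have hinj : Function.Injective L := by
    rw [injective_iff_map_eq_zero]
    rintro ⟨v, t⟩ hvt
    rw [hL] at hvt
    have ht : t = 0 := by
      have := congrArg (fun a => G (f y) (ν y) a) hvt
      simpa [hf.normal y hy, hf.inner_self y hy, hf.sign_ne_zero] using this
    subst ht
    have hv : v = 0 := hf.nondegenerate y hy v fun w => by
      rw [zero_smul, add_zero] at hvt
      rw [pullbackMetric_apply, hvt]
      simp
    rw [hv]; rfl
  have hsurj : Function.Surjective L := by
    rwa [← LinearMap.injective_iff_surjective_of_finrank_eq_finrank]
    rw [hf.finrank_eq, Module.finrank_prod, Module.finrank_self]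
  apply hf.metric.nondegenerate _ (hf.mapsTo hy)
  intro b
  obtain ⟨⟨v, t⟩, rfl⟩ := hsurj b
  rw [hL, map_add, map_smul, h, hν, smul_zero, add_zero]

theorem eq_of_inner {a b : F} (h : ∀ w, G (f y) a (fderiv ℝ f y w) = G (f y) b (fderiv ℝ f y w))
    (hν : G (f y) a (ν y) = G (f y) b (ν y)) : a = b := by
  rw [← sub_eq_zero]
  exact hf.eq_zero_of_inner hy (fun w => by simp [h w]) (by simp [hν])

omit [FiniteDimensional ℝ E] in
theorem inner_covDerivAlong_normal_self (u : E) :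
    G (f y) (covDerivAlong G f ν y u) (ν y) = 0 := by
  have hν := hf.differentiableAt_normal hy
  have h1 := fderiv_inner_along hf.metric (hf.mapsTo hy) (hf.differentiableAt_map hy) hν hν u
  have h2 : (fun z => G (f z) (ν z) (ν z)) =ᶠ[nhds y] fun _ => ε := by
    filter_upwards [hf.mem_nhds hy] with z hz using hf.inner_self z hz
  rw [h2.fderiv_eq, hf.metric.symm _ (hf.mapsTo hy) (ν y)] at h1
  simp at h1
  linarith

/-- The Weingarten formula. -/
theorem weingarten (u : E) :
    covDerivAlong G f ν y u = -fderiv ℝ f y (shapeOp G f ν y u) := by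
  apply hf.eq_of_inner hy
  · intro w
    have := hf.inner_shapeOp hy u w
    rw [pullbackMetric_apply] at this
    rw [map_neg, neg_apply, this, neg_neg]
  · rw [hf.inner_covDerivAlong_normal_self hy, map_neg, neg_apply, hf.inner_fderiv_normal hy,
      neg_zero]

/-- Differentiate ⟨ν, df(v)⟩ = 0 and use the definition of the shape operator. -/
theorem inner_covDerivAlong_fderiv_normal (u v : E) :
    G (f y) (covDerivAlong G f (fun z => fderiv ℝ f z v) y u) (ν y) =
      pullbackMetric G f y (shapeOp G f ν y u) v := by
  have hd := hf.differentiableAt_fderiv hy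
  have h1 := fderiv_inner_along (t := fun z => fderiv ℝ f z v) hf.metric (hf.mapsTo hy)
    (hf.differentiableAt_map hy) (hf.differentiableAt_normal hy) (by fun_prop) u
  have h2 : (fun z => G (f z) (ν z) (fderiv ℝ f z v)) =ᶠ[nhds y] fun _ => 0 := by
    filter_upwards [hf.mem_nhds hy] with z hz using hf.normal z hz v
  rw [h2.fderiv_eq, hf.metric.symm _ (hf.mapsTo hy) (ν y)] at h1
  simp at h1
  rw [hf.inner_shapeOp hy]
  linarith

/-- The Gauss formula. -/
theorem gauss_formula (u v : E) :
    covDerivAlong G f (fun z => fderiv ℝ f z v) y u =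
      fderiv ℝ f y (christoffel (pullbackMetric G f) y u v)
        + (ε * pullbackMetric G f y (shapeOp G f ν y u) v) • ν y := by
  apply hf.eq_of_inner hy
  · intro w
    have h := hf.isLocalMetric_pullbackMetric.inner_christoffel hy u v w
    rw [pullbackMetric_apply, koszul_pullbackMetric hf.metric (hf.mapsTo hy)
      (hf.contDiffAt_map y hy), ← hf.metric.inner_christoffel (hf.mapsTo hy)] at h
    simp only [hf.covDerivAlong_fderiv hy, map_add, add_apply, map_smul, smul_apply, h,
      hf.normal y hy, smul_eq_mul]
    ring
  · rw [hf.inner_covDerivAlong_fderiv_normal hy]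
    simp only [map_add, add_apply, map_smul, smul_apply, hf.inner_fderiv_normal hy,
      hf.inner_self y hy, smul_eq_mul]
    linear_combination (-pullbackMetric G f y (shapeOp G f ν y u) v) * hf.sign_mul_self

/-- Both sides are values of the second fundamental form, which is symmetric because second
derivatives of `f` and the Christoffel symbols are. -/
theorem inner_shapeOp_comm (u v : E) :
    pullbackMetric G f y (shapeOp G f ν y u) v = pullbackMetric G f y u (shapeOp G f ν y v) := by
  rw [hf.isLocalMetric_pullbackMetric.symm y hy u, ← hf.inner_covDerivAlong_fderiv_normal hy,
    ← hf.inner_covDerivAlong_fderiv_normal hy, hf.covDerivAlong_fderiv hy,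
    hf.covDerivAlong_fderiv hy, fderiv_fderiv_comm (hf.contDiffAt_map y hy),
    hf.metric.christoffel_symm (hf.mapsTo hy)]

theorem contDiffAt_shapeOp : ContDiffAt ℝ ∞ (shapeOp G f ν) y := by
  have h1 := hf.isLocalMetric_pullbackMetric.contDiffAt_inverse hy
  have h2 := contDiffAt_covDerivAlong' hf.metric (hf.mapsTo hy) (hf.contDiffAt_map y hy)
    (hf.contDiffAt_normal y hy)
  have h3 := contDiffAt_fderiv (hf.contDiffAt_map y hy)
  have h4 : ContDiffAt ℝ ∞ (fun z => G (f z)) y :=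
    (hf.metric.contDiffAt _ (hf.mapsTo hy)).comp y (hf.contDiffAt_map y hy)
  have hflip : ContDiff ℝ ∞ (fun D : E →L[ℝ] E →L[ℝ] ℝ => D.flip) :=
    (ContinuousLinearMap.flipₗᵢ ℝ E E ℝ).toContinuousLinearEquiv.contDiff
  have hflip' : ContDiff ℝ ∞ (fun D : E →L[ℝ] F →L[ℝ] ℝ => D.flip) :=
    (ContinuousLinearMap.flipₗᵢ ℝ E F ℝ).toContinuousLinearEquiv.contDiff
  have h5 := (hflip.contDiffAt.comp y
    ((hflip'.contDiffAt.comp y (h4.clm_comp h2)).clm_comp h3)).neg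
  exact h1.clm_comp h5

theorem differentiableAt_shapeOp : DifferentiableAt ℝ (shapeOp G f ν) y :=
  (hf.contDiffAt_shapeOp hy).differentiableAt (by simp)

/-- The Gauss formula for the tangential field of components `X`. -/
theorem covDerivAlong_tangential {X : E → E} (hX : DifferentiableAt ℝ X y) (u : E) :
    covDerivAlong G f (fun z => fderiv ℝ f z (X z)) y u =
      fderiv ℝ f y (fderiv ℝ X y u + christoffel (pullbackMetric G f) y u (X y))
        + (ε * pullbackMetric G f y (shapeOp G f ν y u) (X y)) • ν y := by
  have h := hf.gauss_formula hy u (X y)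
  rw [hf.covDerivAlong_fderiv hy] at h
  rw [covDerivAlong_apply, fderiv_clm_apply (hf.differentiableAt_fderiv hy) hX, map_add, add_assoc,
    ← h]
  simp
  abel

/-- By Weingarten, ∇̃_v ν is minus the tangential field with components Av, to which the Gauss
formula applies. -/
theorem covDerivAlong_covDerivAlong_normal (u v : E) :
    covDerivAlong G f (fun z => covDerivAlong G f ν z v) y u =
      -(fderiv ℝ f y (fderiv ℝ (shapeOp G f ν) y u v
          + christoffel (pullbackMetric G f) y u (shapeOp G f ν y v))
        + (ε * pullbackMetric G f y (shapeOp G f ν y u) (shapeOp G f ν y v)) • ν y) := by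
  have hA := hf.differentiableAt_shapeOp hy
  have h1 : (fun z => covDerivAlong G f ν z v) =ᶠ[nhds y]
      fun z => -(fun z => fderiv ℝ f z (shapeOp G f ν z v)) z := by
    filter_upwards [hf.mem_nhds hy] with z hz using hf.weingarten hz v
  rw [covDerivAlong_congr h1, covDerivAlong_neg, neg_apply, ← fderiv_clm_apply_const hA,
    hf.covDerivAlong_tangential hy (X := fun z => shapeOp G f ν z v) (by fun_prop)]

variable {c : ℝ} (hc : ∀ z ∈ V, ∀ u v w, curvature G z u v w = c • (G z v w • u - G z u w • v))

include hc

/-- The Codazzi equation in a space of constant curvature. -/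
theorem codazzi (u v : E) :
    covDerivEnd (christoffel (pullbackMetric G f)) (shapeOp G f ν) y u v =
      covDerivEnd (christoffel (pullbackMetric G f)) (shapeOp G f ν) y v u := by
  have h := covDerivAlong_comm hf.metric (hf.mapsTo hy) (hf.contDiffAt_map y hy)
    (hf.contDiffAt_normal y hy) u v
  rw [hc _ (hf.mapsTo hy), hf.inner_fderiv_normal hy, hf.inner_fderiv_normal hy,
    hf.covDerivAlong_covDerivAlong_normal hy, hf.covDerivAlong_covDerivAlong_normal hy,
    hf.isLocalMetric_pullbackMetric.symm y hy (shapeOp G f ν y v)] at h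
  -- R(df u, df v)ν = 0 since ν is normal, and the normal components cancel by symmetry. What
  -- remains lies in the image of df.
  have h' := hf.fderiv_injective hy (a₁ := fderiv ℝ (shapeOp G f ν) y u v
      + christoffel (pullbackMetric G f) y u (shapeOp G f ν y v))
    (a₂ := fderiv ℝ (shapeOp G f ν) y v u
      + christoffel (pullbackMetric G f) y v (shapeOp G f ν y u))
    (by
      rw [zero_smul, zero_smul, sub_zero, smul_zero] at h
      rw [← sub_eq_zero, ← neg_eq_zero, ← h]
      abel)
  simp only [covDerivEnd_apply, sub_apply, add_apply, ContinuousLinearMap.mul_def,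
    ContinuousLinearMap.comp_apply, h',
    hf.isLocalMetric_pullbackMetric.christoffel_symm hy u v]

/-- The Gauss equation in a space of constant curvature. -/
theorem gauss_equation (u v w : E) :
    curvature (pullbackMetric G f) y u v w =
      c • (pullbackMetric G f y v w • u - pullbackMetric G f y u w • v)
        + ε • (pullbackMetric G f y (shapeOp G f ν y v) w • shapeOp G f ν y u
          - pullbackMetric G f y (shapeOp G f ν y u) w • shapeOp G f ν y v) := by
  have hΓ := hf.isLocalMetric_pullbackMetric.differentiableAt_christoffel hy
  -- The tangential part of the second covariant derivative of df(w): the intrinsic one, plus the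
  -- Weingarten term of the normal component. Antisymmetrizing in `a`, `b` gives the Gauss equation.
  have key : ∀ a b d : E, G (f y) (covDerivAlong G f
      (fun z => covDerivAlong G f (fun z => fderiv ℝ f z w) z b) y a) (fderiv ℝ f y d) =
      pullbackMetric G f y (fderiv ℝ (christoffel (pullbackMetric G f)) y a b w
        + christoffel (pullbackMetric G f) y a (christoffel (pullbackMetric G f) y b w)
        - (ε * pullbackMetric G f y (shapeOp G f ν y b) w) • shapeOp G f ν y a) d := by
    intro a b d
    have hA := hf.differentiableAt_shapeOp hy
    have hh := hf.isLocalMetric_pullbackMetric.differentiableAt hy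
    have hν := hf.differentiableAt_normal hy
    have hdf := hf.differentiableAt_fderiv hy
    have h1 : (fun z => covDerivAlong G f (fun z => fderiv ℝ f z w) z b) =ᶠ[nhds y] fun z =>
        fderiv ℝ f z (christoffel (pullbackMetric G f) z b w)
          + (ε * pullbackMetric G f z (shapeOp G f ν z b) w) • ν z := by
      filter_upwards [hf.mem_nhds hy] with z hz using hf.gauss_formula hz b w
    rw [covDerivAlong_congr h1, covDerivAlong_add (by fun_prop) (by fun_prop), add_apply,
      hf.covDerivAlong_tangential hy (by fun_prop), covDerivAlong_smul (by fun_prop) hν,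
      hf.weingarten hy, fderiv_clm_apply₂_const hΓ]
    simp only [map_add, add_apply, map_smul, smul_apply, hf.normal y hy, map_neg, neg_apply,
      pullbackMetric_apply, map_sub, sub_apply, smul_eq_mul]
    ring
  have hcomm := covDerivAlong_comm (s := fun z => fderiv ℝ f z w) hf.metric (hf.mapsTo hy)
    (hf.contDiffAt_map y hy)
    ((contDiffAt_fderiv (hf.contDiffAt_map y hy)).clm_apply contDiffAt_const) u v
  rw [hc _ (hf.mapsTo hy)] at hcomm
  apply hf.isLocalMetric_pullbackMetric.ext_inner hy
  intro d
  have h := congrArg (fun a => G (f y) a (fderiv ℝ f y d)) hcomm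
  simp only [map_sub, sub_apply, key, map_smul, smul_apply, smul_eq_mul, map_add, add_apply,
    ← pullbackMetric_apply] at h
  rw [hf.isLocalMetric_pullbackMetric.curvature_eq hy]
  simp only [map_sub, sub_apply, map_smul, smul_apply, smul_eq_mul, map_add, add_apply]
  linarith

end

end IsLocalHypersurface

/-! ### Traces and the Laplacian -/

section Trace

variable {m : ℕ}

theorem trace_coord (B : Coord m →ₗ[ℝ] Coord m) :
    LinearMap.trace ℝ (Coord m) B = ∑ i, B (EuclideanSpace.single i 1) i := by
  rw [LinearMap.trace_eq_sum_inner B (EuclideanSpace.basisFun (Fin m) ℝ)]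
  simp [EuclideanSpace.inner_single_left]

theorem sum_coord_smul_single (x : Coord m) : ∑ j, x j • EuclideanSpace.single j (1 : ℝ) = x := by
  have := (EuclideanSpace.basisFun (Fin m) ℝ).sum_repr x
  simpa using this

variable {h : Coord m →L[ℝ] Coord m →L[ℝ] ℝ} (hs : ∀ u v, h u v = h v u)
  (hn : ∀ u, (∀ v, h u v = 0) → u = 0)

include hn

-- The vector with components h^{ij}, i fixed, is the h-dual of the i-th coordinate functional, so
-- the sum over j extracts the i-th coordinate of B e_i.
include hs in
theorem sum_invEntry_mul (B : Coord m →L[ℝ] Coord m) :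
    ∑ i, ∑ j, invEntry h i j * h (B (EuclideanSpace.single i 1)) (EuclideanSpace.single j 1) =
      LinearMap.trace ℝ (Coord m) B := by
  rw [trace_coord]
  refine Finset.sum_congr rfl fun i _ => ?_
  have key : h (B (EuclideanSpace.single i 1)) (h.inverse (EuclideanSpace.proj i)) =
      B (EuclideanSpace.single i 1) i := by
    rw [hs, (isInvertible_of_nondegenerate hn).self_apply_inverse]
    simp
  rw [ContinuousLinearMap.coe_coe, ← key]
  conv_rhs => rw [← sum_coord_smul_single (h.inverse (EuclideanSpace.proj i))]
  simp [invEntry]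

include hs in
theorem sum_invEntry_mul_left (φ : Coord m →L[ℝ] ℝ) (x : Coord m) :
    ∑ i, ∑ j, invEntry h i j * (φ (EuclideanSpace.single i 1) * h x (EuclideanSpace.single j 1)) =
      φ x := by
  have := sum_invEntry_mul hs hn (φ.smulRight x)
  simp only [ContinuousLinearMap.smulRight_apply, map_smul, smul_apply, smul_eq_mul] at this
  rw [this]
  exact LinearMap.trace_smulRight φ.toLinearMap x

-- The same contraction with i and j exchanged. It is obtained from the rank-one map with functional
-- h(x, ·) and vector the h-dual of φ, with no appeal to the symmetry of h^{ij}.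
include hs in
theorem sum_invEntry_mul_right (φ : Coord m →L[ℝ] ℝ) (x : Coord m) :
    ∑ i, ∑ j, invEntry h i j * (φ (EuclideanSpace.single j 1) * h x (EuclideanSpace.single i 1)) =
      φ x := by
  have := sum_invEntry_mul hs hn ((h x).smulRight (h.inverse φ))
  simp only [ContinuousLinearMap.smulRight_apply, map_smul, smul_apply, smul_eq_mul,
    (isInvertible_of_nondegenerate hn).self_apply_inverse] at this
  simp only [mul_comm (φ _), this]
  refine (LinearMap.trace_smulRight (h x).toLinearMap (h.inverse φ)).trans ?_
  rw [ContinuousLinearMap.coe_coe, hs, (isInvertible_of_nondegenerate hn).self_apply_inverse]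

end Trace

section CovDerivEnd

variable {E : Type*} [NormedAddCommGroup E] [NormedSpace ℝ E] [FiniteDimensional ℝ E]
  {h : E → E →L[ℝ] E →L[ℝ] ℝ} {U : Set E}

/-- The covariant derivative of a self-adjoint field of endomorphisms is self-adjoint. -/
theorem IsLocalMetric.inner_covDerivEnd_comm (hh : IsLocalMetric h U) {A : E → E →L[ℝ] E}
    (hsa : ∀ y ∈ U, ∀ v w, h y (A y v) w = h y v (A y w)) {y : E} (hy : y ∈ U)
    (hA : DifferentiableAt ℝ A y) (u v w : E) :
    h y (covDerivEnd (christoffel h) A y u v) w =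
      h y v (covDerivEnd (christoffel h) A y u w) := by
  have h1 := fderiv_bilin_comp (f := fun z => z) (s := fun z => A z v)
    (t := fun _ => w) (y := y) (hh.differentiableAt hy) (by fun_prop) (by fun_prop) (by fun_prop) u
  have h2 := fderiv_bilin_comp (f := fun z => z) (s := fun _ => v)
    (t := fun z => A z w) (y := y) (hh.differentiableAt hy) (by fun_prop) (by fun_prop)
    (by fun_prop) u
  have h3 : (fun z => h z (A z v) w) =ᶠ[nhds y] fun z => h z v (A z w) := by
    filter_upwards [hh.mem_nhds hy] with z hz using hsa z hz v w
  rw [h3.fderiv_eq, h2] at h1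
  simp only [hh.fderiv_eq hy, fderiv_clm_apply_const hA, fderiv_fun_id, fderiv_fun_const,
    ContinuousLinearMap.coe_id', id_eq, Pi.zero_apply, zero_apply, map_zero, add_zero] at h1
  simp only [covDerivEnd_apply, map_sub, map_add, sub_apply, add_apply,
    ContinuousLinearMap.mul_def, ContinuousLinearMap.comp_apply, hsa y hy (christoffel h y u v),
    ← hsa y hy v]
  linarith

end CovDerivEnd

/-! ### Tangential and normal parts of the Laplacian of a normal field. -/

namespace IsLocalHypersurface

section General

variable {E F : Type*} [NormedAddCommGroup E] [NormedSpace ℝ E]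
  [NormedAddCommGroup F] [NormedSpace ℝ F] [FiniteDimensional ℝ E] [FiniteDimensional ℝ F]
  {G : F → F →L[ℝ] F →L[ℝ] ℝ} {V : Set F} {f ν : E → F} {U : Set E} {ε : ℝ}
  (hf : IsLocalHypersurface G V f ν U ε) {y : E} (hy : y ∈ U)

include hf hy

/-- The second covariant derivative of the normal field `φ ν`. -/
theorem covDerivAlong_covDerivAlong_smul_normal {φ : E → ℝ} (hφ : ∀ z ∈ U, ContDiffAt ℝ ∞ φ z)
    (u v : E) :
    covDerivAlong G f (fun z => covDerivAlong G f (fun z => φ z • ν z) z v) y u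
        - covDerivAlong G f (fun z => φ z • ν z) y (christoffel (pullbackMetric G f) y u v) =
      (fderiv ℝ (fderiv ℝ φ) y u v - fderiv ℝ φ y (christoffel (pullbackMetric G f) y u v)
          - ε * φ y * pullbackMetric G f y (shapeOp G f ν y u) (shapeOp G f ν y v)) • ν y
        - fderiv ℝ f y (fderiv ℝ φ y u • shapeOp G f ν y v + fderiv ℝ φ y v • shapeOp G f ν y u
          + φ y • covDerivEnd (christoffel (pullbackMetric G f)) (shapeOp G f ν) y u v) := by
  have hd : ∀ z ∈ U, DifferentiableAt ℝ φ z := fun z hz =>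
    (hφ z hz).differentiableAt (by simp)
  have hdd : DifferentiableAt ℝ (fderiv ℝ φ) y :=
    (contDiffAt_fderiv (hφ y hy)).differentiableAt (by simp)
  have hφy := hd y hy
  have hν := hf.differentiableAt_normal hy
  have hDν : DifferentiableAt ℝ (fun z => covDerivAlong G f ν z v) y :=
    (contDiffAt_covDerivAlong hf.metric (hf.mapsTo hy) (hf.contDiffAt_map y hy)
      (hf.contDiffAt_normal y hy) v).differentiableAt (by simp)
  have h1 : (fun z => covDerivAlong G f (fun z => φ z • ν z) z v) =ᶠ[nhds y]
      fun z => fderiv ℝ φ z v • ν z + φ z • covDerivAlong G f ν z v := by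
    filter_upwards [hf.mem_nhds hy] with z hz using
      covDerivAlong_smul (hd z hz) (hf.differentiableAt_normal hz) v
  rw [covDerivAlong_congr h1, covDerivAlong_add (by fun_prop) (by fun_prop), add_apply,
    covDerivAlong_smul (by fun_prop) hν, covDerivAlong_smul hφy hDν, covDerivAlong_smul hφy hν,
    hf.covDerivAlong_covDerivAlong_normal hy, hf.weingarten hy, hf.weingarten hy, hf.weingarten hy,
    fderiv_clm_apply_const hdd, covDerivEnd_apply]
  simp only [map_add, map_sub, map_smul, sub_apply, add_apply, ContinuousLinearMap.mul_def,
    ContinuousLinearMap.comp_apply]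
  module

end General

variable {m n : ℕ} {G : Coord n → Coord n →L[ℝ] Coord n →L[ℝ] ℝ} {V : Set (Coord n)}
  {f ν : Coord m → Coord n} {U : Set (Coord m)} {ε : ℝ}
  (hf : IsLocalHypersurface G V f ν U ε) {y : Coord m} (hy : y ∈ U)
  {φ : Coord m → ℝ} (hφ : ∀ z ∈ U, ContDiffAt ℝ ∞ φ z)

include hf hy hφ

/-- The tangential part of the Laplacian of `φ ν`. -/
theorem inner_laplacian_fderiv {c : ℝ}
    (hc : ∀ z ∈ V, ∀ u v w, curvature G z u v w = c • (G z v w • u - G z u w • v)) (w : Coord m) :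
    G (f y) (laplacian G f (fun z => φ z • ν z) y) (fderiv ℝ f y w) =
      2 * fderiv ℝ φ y (shapeOp G f ν y w)
        + φ y * LinearMap.trace ℝ (Coord m) (fderiv ℝ (shapeOp G f ν) y w) := by
  have hh := hf.isLocalMetric_pullbackMetric
  set T := covDerivEnd (christoffel (pullbackMetric G f)) (shapeOp G f ν) y with hT
  -- ∇_w A differs from ∂_w A by a commutator, which is traceless.
  have htr : LinearMap.trace ℝ (Coord m) (T w) =
      LinearMap.trace ℝ (Coord m) (fderiv ℝ (shapeOp G f ν) y w) := by
    have := LinearMap.trace_mul_comm ℝ (christoffel (pullbackMetric G f) y w).toLinearMap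
      (shapeOp G f ν y).toLinearMap
    rw [hT, covDerivEnd_apply, ContinuousLinearMap.toLinearMap_sub,
      ContinuousLinearMap.toLinearMap_add, map_sub, map_add]
    rw [Module.End.mul_eq_comp, Module.End.mul_eq_comp] at this
    exact (congrArg₂ _ (congrArg _ this) rfl).trans (add_sub_cancel_right _ _)
  rw [laplacian, ← htr, ← sum_invEntry_mul (hh.symm y hy) (hh.nondegenerate y hy),
    ← sum_invEntry_mul_left (hh.symm y hy) (hh.nondegenerate y hy), two_mul]
  nth_rw 2 [sum_invEntry_mul_left (hh.symm y hy) (hh.nondegenerate y hy)]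
  rw [← sum_invEntry_mul_right (hh.symm y hy) (hh.nondegenerate y hy)]
  simp only [hf.covDerivAlong_covDerivAlong_smul_normal hy hφ, ← Finset.sum_neg_distrib,
    Finset.mul_sum, ← Finset.sum_add_distrib, map_sum, map_neg, map_smul, sum_apply, neg_apply,
    smul_apply, map_sub, sub_apply, hf.normal y hy, ← hT]
  refine Finset.sum_congr rfl fun i _ => Finset.sum_congr rfl fun j _ => ?_
  rw [← pullbackMetric_apply]
  simp only [map_add, add_apply, map_smul, smul_apply, smul_eq_mul]
  have h1 : ∀ u, pullbackMetric G f y (shapeOp G f ν y u) w =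
      pullbackMetric G f y (shapeOp G f ν y w) u := fun u => by
    rw [hf.inner_shapeOp_comm hy, hh.symm y hy]
  -- Codazzi and self-adjointness move `w` into the differentiation slot, so that contracting over
  -- `u`, `v` yields tr(∇_w A).
  have h2 : ∀ u v, pullbackMetric G f y (T u v) w = pullbackMetric G f y (T w u) v := by
    intro u v
    rw [hT, hh.inner_covDerivEnd_comm (fun z hz => hf.inner_shapeOp_comm hz) hy
      (hf.differentiableAt_shapeOp hy), hf.codazzi hy hc u w, hh.symm y hy]
  rw [h1, h1, h2]
  ring

/-- The normal part of the Laplacian of `φ ν`, for locally constant `φ`. -/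
theorem inner_laplacian_normal (hconst : fderiv ℝ φ =ᶠ[nhds y] 0) :
    G (f y) (laplacian G f (fun z => φ z • ν z) y) (ν y) =
      φ y * LinearMap.trace ℝ (Coord m) (shapeOp G f ν y ∘L shapeOp G f ν y).toLinearMap := by
  have hh := hf.isLocalMetric_pullbackMetric
  rw [laplacian, ← sum_invEntry_mul (hh.symm y hy) (hh.nondegenerate y hy)]
  simp only [hf.covDerivAlong_covDerivAlong_smul_normal hy hφ, ← Finset.sum_neg_distrib,
    Finset.mul_sum, map_sum, map_neg, map_smul, sum_apply, neg_apply, smul_apply, map_sub,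
    sub_apply, hf.inner_self y hy, hf.inner_fderiv_normal hy, hconst.fderiv_eq, hconst.eq_of_nhds]
  refine Finset.sum_congr rfl fun i _ => Finset.sum_congr rfl fun j _ => ?_
  rw [ContinuousLinearMap.comp_apply, hf.inner_shapeOp_comm hy
    (shapeOp G f ν y _)]
  simp only [Pi.zero_apply, fderiv_zero, zero_apply, smul_eq_mul]
  linear_combination (invEntry (pullbackMetric G f y) i j * φ y *
    pullbackMetric G f y (shapeOp G f ν y (EuclideanSpace.single i 1))
      (shapeOp G f ν y (EuclideanSpace.single j 1))) * hf.sign_mul_self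

end IsLocalHypersurface

/-! ### Endomorphisms with two nonreal eigenvalues -/

section Algebra

/-- T - JTJ is twice the J-linear part of T, and J(T - JTJ) = P with P = JT + TJ. Write E for the
left side of `hE`. Replacing K by J - JS/2 gives E = SP + PS - SPS/2, and since SE + ES = 2SPS, the
combination E + (SE + ES)/4 is exactly SP + PS. -/
theorem anticomm_of_square_zero {R : Type*} [Ring R] [Algebra ℝ R] {J S K T : R}
    (hJ : J * J = -1) (hJS : S * J = J * S) (hS : S * S = 0)
    (hK : K = J - (1 / 2 : ℝ) • (J * S))
    (hE : S * (K * T + T * K) + (K * T + T * K) * S = 0) :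
    S * (T - J * T * J) + (T - J * T * J) * S = 0 := by
  have h1 : ∀ a, J * (J * a) = -a := fun a => by rw [← mul_assoc, hJ, neg_one_mul]
  have h2 : ∀ a, S * (S * a) = 0 := fun a => by rw [← mul_assoc, hS, zero_mul]
  have h3 : ∀ a, S * (J * a) = J * (S * a) := fun a => by rw [← mul_assoc, hJS, mul_assoc]
  have key : S * (T - J * T * J) + (T - J * T * J) * S =
      -(J * ((S * (K * T + T * K) + (K * T + T * K) * S)
        + (1 / 4 : ℝ) • (S * (S * (K * T + T * K) + (K * T + T * K) * S)
          + (S * (K * T + T * K) + (K * T + T * K) * S) * S))) := by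
    rw [hK]
    simp only [mul_add, add_mul, mul_sub, sub_mul, mul_assoc, h1, h2, h3, hS, zero_mul,
      smul_mul_assoc, mul_smul_comm, smul_sub, smul_add, mul_zero, smul_zero, smul_neg]
    module
  rw [key, hE]
  simp

variable {E : Type*} [NormedAddCommGroup E] [NormedSpace ℝ E]
  {h : E →L[ℝ] E →L[ℝ] ℝ}

/-- A square-zero complex endomorphism of a complex plane is nilpotent with a cyclic vector. -/
theorem exists_cyclic_basis (hdim : Module.finrank ℝ E = 4) {J S : E →L[ℝ] E} (hJ : J * J = -1)
    (hJS : S * J = J * S) (hS : S * S = 0) (hS0 : S ≠ 0) :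
    ∃ (u : E) (B : Module.Basis (Fin 4) ℝ E), ⇑B = ![u, J u, S u, J (S u)] ∧
      ∀ a b : ℝ, a • S u + b • J (S u) = 0 → a = 0 ∧ b = 0 := by
  have hJ' : ∀ a, J (J a) = -a := fun a => congrArg (· a) hJ
  have hS' : ∀ a, S (S a) = 0 := fun a => congrArg (· a) hS
  have hJS' : ∀ a, S (J a) = J (S a) := fun a => congrArg (· a) hJS
  obtain ⟨u, hu⟩ : ∃ u, S u ≠ 0 := by
    by_contra! h0
    exact hS0 (by ext a; simp [h0 a])
  have hind : ∀ a b : ℝ, a • S u + b • J (S u) = 0 → a = 0 ∧ b = 0 := by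
    intro a b hab
    have h1 := congrArg J hab
    simp only [map_add, map_smul, hJ', map_zero] at h1
    -- For J as complex unit, this multiplies (a + bJ)Su = 0 by the conjugate a - bJ.
    have h2 : (a ^ 2 + b ^ 2) • S u = 0 := by
      have : (a ^ 2 + b ^ 2) • S u = a • (a • S u + b • J (S u)) - b • (a • J (S u) + b • -S u) := by
        module
      rw [this, hab, h1]; simp
    have h3 := (smul_eq_zero.1 h2).resolve_right hu
    constructor <;> nlinarith [sq_nonneg a, sq_nonneg b]
  have hli : LinearIndependent ℝ ![u, J u, S u, J (S u)] := by
    rw [Fintype.linearIndependent_iff]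
    intro g hg
    simp only [Fin.sum_univ_four, Matrix.cons_val_zero, Matrix.cons_val_one, Matrix.cons_val]
      at hg
    have h1 := congrArg S hg
    simp only [map_add, map_smul, hJS', hS', map_zero, smul_zero, add_zero] at h1
    obtain ⟨h0, h1⟩ := hind _ _ h1
    rw [h0, h1, zero_smul, zero_smul, zero_add, zero_add] at hg
    obtain ⟨h2, h3⟩ := hind _ _ hg
    intro i
    fin_cases i <;> assumption
  exact ⟨u, .mk hli (hli.span_eq_top_of_card_eq_finrank (by simp [hdim])).ge,
    Module.Basis.coe_mk _ _, hind⟩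

/-- ker S = im S: in the cyclic basis S is injective on the span of u, Ju and kills Su, JSu. -/
theorem exists_eq_of_apply_eq_zero (hdim : Module.finrank ℝ E = 4) {J S : E →L[ℝ] E}
    (hJ : J * J = -1) (hJS : S * J = J * S) (hS : S * S = 0) (hS0 : S ≠ 0) {x : E} (hx : S x = 0) :
    ∃ w, x = S w := by
  obtain ⟨u, B, hB, hind⟩ := exists_cyclic_basis hdim hJ hJS hS hS0
  have hS' : ∀ a, S (S a) = 0 := fun a => congrArg (· a) hS
  have hJS' : ∀ a, S (J a) = J (S a) := fun a => congrArg (· a) hJS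
  have hsum := B.sum_repr x
  simp only [hB, Fin.sum_univ_four, Matrix.cons_val_zero, Matrix.cons_val_one, Matrix.cons_val]
    at hsum
  have h1 := congrArg S hsum
  simp only [map_add, map_smul, hJS', hS', map_zero, smul_zero, add_zero, hx] at h1
  obtain ⟨h0, h1⟩ := hind _ _ h1
  refine ⟨B.repr x 2 • u + B.repr x 3 • J u, ?_⟩
  rw [h0, h1, zero_smul, zero_smul, zero_add, zero_add] at hsum
  rw [map_add, map_smul, map_smul, hJS', hsum]

/-- For a cyclic vector u, self-adjointness gives ⟨tSu, u⟩ = ⟨Stu, u⟩, while anticommutation gives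
tSu = -Stu; so Stu is orthogonal to u, and likewise to Ju. It is orthogonal to im S because S² = 0.
Hence Stu = 0 = tSu, and J-linearity of t does the rest. -/
theorem comp_eq_zero_of_anticomm (hdim : Module.finrank ℝ E = 4)
    (hs : ∀ u v, h u v = h v u) (hn : ∀ u, (∀ v, h u v = 0) → u = 0)
    {J S t : E →L[ℝ] E} (hJsa : ∀ u v, h (J u) v = h u (J v)) (hSsa : ∀ u v, h (S u) v = h u (S v))
    (htsa : ∀ u v, h (t u) v = h u (t v)) (hJ : J * J = -1) (hJS : S * J = J * S) (hS : S * S = 0)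
    (hS0 : S ≠ 0) (htJ : t * J = J * t) (htS : S * t + t * S = 0) : t * S = 0 := by
  have hJ' : ∀ a, J (J a) = -a := fun a => congrArg (· a) hJ
  have hS' : ∀ a, S (S a) = 0 := fun a => congrArg (· a) hS
  have hJS' : ∀ a, S (J a) = J (S a) := fun a => congrArg (· a) hJS
  have htJ' : ∀ a, t (J a) = J (t a) := fun a => congrArg (· a) htJ
  have htS' : ∀ a, S (t a) + t (S a) = 0 := fun a => congrArg (· a) htS
  obtain ⟨u, B, hB, -⟩ := exists_cyclic_basis hdim hJ hJS hS hS0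
  have ext_h : ∀ a, (∀ i, h a (![u, J u, S u, J (S u)] i) = 0) → a = 0 := by
    intro a ha
    apply hn
    have : (h a).toLinearMap = 0 := B.ext fun i => by simpa [hB] using ha i
    exact fun v => congrArg (· v) this
  have hStu : S (t u) = 0 := by
    apply ext_h
    intro i
    fin_cases i
    · have := congrArg (fun a => h a u) (htS' u)
      simp only [map_add, add_apply, map_zero, zero_apply] at this
      have h1 : h (t (S u)) u = h (S (t u)) u := by rw [htsa, hSsa, hs, hSsa, hs, hSsa]
      change h (S (t u)) u = 0
      linarith
    · have := congrArg (fun a => h a (J u)) (htS' u)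
      simp only [map_add, add_apply, map_zero, zero_apply] at this
      have h1 : h (t (S u)) (J u) = h (S (t u)) (J u) := by
        rw [htsa, htJ', hSsa, hJS', ← hJsa, hs]
      change h (S (t u)) (J u) = 0
      linarith
    · change h (S (t u)) (S u) = 0
      rw [hSsa, hS', map_zero]
    · change h (S (t u)) (J (S u)) = 0
      rw [hSsa, hJS', hS', map_zero, map_zero]
  have htSu : t (S u) = 0 := by simpa [hStu] using htS' u
  have : (t * S).toLinearMap = 0 := by
    apply B.ext
    intro i
    rw [hB]
    fin_cases i
    · exact htSu
    · change t (S (J u)) = 0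
      rw [hJS', htJ', htSu, map_zero]
    · change t (S (S u)) = 0
      rw [hS', map_zero]
    · change t (S (J (S u))) = 0
      rw [hJS', hS', map_zero, map_zero]
  ext v
  exact congrArg (· v) this

variable {K : E →L[ℝ] E} {T : E →L[ℝ] E →L[ℝ] E}

/-- Pointwise consequence of the Codazzi equation for a field of self-adjoint endomorphisms `K`
with `(K² + 1)² = 0`, where `T` is the covariant derivative of `K`: on the kernel of
`S = K² + 1 ≠ 0`, the values of `T` commute with `K`, and their products with one another
vanish. -/
theorem commute_of_codazzi (hdim : Module.finrank ℝ E = 4)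
    (hs : ∀ u v, h u v = h v u) (hn : ∀ u, (∀ v, h u v = 0) → u = 0)
    (hK : ∀ u v, h (K u) v = h u (K v)) (hT : ∀ u v w, h (T u v) w = h v (T u w))
    (hcod : ∀ u v, T u v = T v u) {S : E →L[ℝ] E} (hSK : S = K * K + 1) (hS : S * S = 0)
    (hS0 : S ≠ 0) (hE : ∀ u, S * (K * T u + T u * K) + (K * T u + T u * K) * S = 0) {x : E}
    (hx : S x = 0) :
    K * T x = T x * K ∧ S * T x = 0 ∧ ∀ x', S x' = 0 → T x * T x' = 0 := by
  have hcomm : S * K = K * S := by rw [hSK]; noncomm_ring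
  have hcomm' : ∀ a, S * (K * a) = K * (S * a) := fun a => by rw [← mul_assoc, hcomm, mul_assoc]
  have hKK : K * K = S - 1 := by rw [hSK]; abel
  have hKK' : ∀ a, K * (K * a) = S * a - a := fun a => by rw [← mul_assoc, hKK, sub_mul, one_mul]
  -- The semisimple part of K. Since (1 + S/2)² = 1 + S, one gets J² = K²(1 + S) = (S - 1)(S + 1) =
  -- -1.
  set J := K + (1 / 2 : ℝ) • (K * S) with hJdef
  have hJJ : J * J = -1 := by
    rw [hJdef]
    simp only [mul_add, add_mul, mul_assoc, smul_mul_assoc, mul_smul_comm, hcomm, hcomm', hKK, hKK',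
      hS, smul_zero, mul_zero, zero_sub, smul_neg]
    module
  have hJS : S * J = J * S := by
    rw [hJdef]
    simp only [mul_add, add_mul, mul_assoc, smul_mul_assoc, mul_smul_comm, hcomm, hcomm', hS]
  have hKJ : K = J - (1 / 2 : ℝ) • (J * S) := by
    rw [hJdef]
    simp only [add_mul, mul_assoc, smul_mul_assoc, hS, mul_zero, smul_zero]
    module
  have hSsa : ∀ u v, h (S u) v = h u (S v) := by
    intro u v
    simp only [hSK, add_apply, ContinuousLinearMap.mul_def, ContinuousLinearMap.comp_apply,
      map_add, hK]
    rfl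
  have hJsa : ∀ u v, h (J u) v = h u (J v) := by
    intro u v
    have : K (S v) = S (K v) := (congrArg (· v) hcomm).symm
    simp only [hJdef, add_apply, smul_apply, ContinuousLinearMap.mul_def,
      ContinuousLinearMap.comp_apply, map_add, map_smul, hK, hSsa, this]
  -- The J-linear part of T_X vanishes on im S, so T_X is J-antilinear there.
  have main : ∀ X, T X * S = J * T X * J * S := by
    intro X
    have h1 := comp_eq_zero_of_anticomm hdim hs hn (t := T X - J * T X * J) hJsa hSsa
      (fun u v => by
        simp only [sub_apply, ContinuousLinearMap.mul_def, ContinuousLinearMap.comp_apply,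
          map_sub, hJsa, hT]) hJJ hJS hS hS0
      (by
        simp only [sub_mul, mul_sub, mul_assoc, hJJ]
        rw [← mul_assoc J J, hJJ]
        noncomm_ring)
      (anticomm_of_square_zero hJJ hJS hS hKJ (hE X))
    rwa [sub_mul, sub_eq_zero] at h1
  -- Codazzi exchanges the differentiation direction with the vector of im S; `right` is the adjoint
  -- identity. Together they make T_{Su} commute with J.
  have left : ∀ u, T (S u) = J * T (J (S u)) := by
    intro u
    ext X
    have := congrArg (· u) (main X)
    simp only [ContinuousLinearMap.mul_def, ContinuousLinearMap.comp_apply] at this ⊢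
    rw [hcod, this, hcod X]
  have right : ∀ u, T (S u) = T (J (S u)) * J := by
    intro u
    ext X
    rw [← sub_eq_zero]
    apply hn
    intro w
    have h1 := congrArg (fun a => h X (a w)) (left u)
    simp only [ContinuousLinearMap.mul_def, ContinuousLinearMap.comp_apply] at h1
    simp only [ContinuousLinearMap.mul_def, ContinuousLinearMap.comp_apply, map_sub, sub_apply, hT,
      hJsa, h1, sub_self]
  have hJT : ∀ u, J * T (S u) = T (S u) * J := by
    intro u
    have h1 : J * T (S u) = -T (J (S u)) := by
      rw [left u, ← mul_assoc, hJJ, neg_one_mul]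
    have h2 : T (S u) * J = -T (J (S u)) := by
      rw [right u, mul_assoc, hJJ, mul_neg_one]
    rw [h1, h2]
  -- T_{Su} both commutes with J and, by `main`, anticommutes with it on im S, so it kills im S.
  have hTS : ∀ u, T (S u) * S = 0 := by
    intro u
    have h1 := main (S u)
    rw [hJT, mul_assoc (T (S u)), hJJ, mul_neg_one, neg_mul] at h1
    have h2 : (2 : ℝ) • (T (S u) * S) = 0 := by
      rw [two_smul]
      nth_rw 1 [h1]
      exact neg_add_cancel _
    exact (smul_eq_zero.1 h2).resolve_left two_ne_zero
  have hST : ∀ u, S * T (S u) = 0 := by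
    intro u
    ext X
    apply hn
    intro w
    have h1 := congrArg (fun a => h X (a w)) (hTS u)
    simp only [ContinuousLinearMap.mul_def, ContinuousLinearMap.comp_apply, zero_apply,
      map_zero] at h1
    simp only [ContinuousLinearMap.mul_def, ContinuousLinearMap.comp_apply, hSsa, hT, h1]
  obtain ⟨u, rfl⟩ := exists_eq_of_apply_eq_zero hdim hJJ hJS hS hS0 hx
  refine ⟨?_, hST u, ?_⟩
  · have hTJS : T (S u) * (J * S) = 0 := by rw [← hJS, ← mul_assoc, hTS, zero_mul]
    rw [hKJ, sub_mul, mul_sub, hJT, smul_mul_assoc, mul_smul_comm, mul_assoc, hST, hTJS, mul_zero]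
  · intro x' hx'
    obtain ⟨u', rfl⟩ := exists_eq_of_apply_eq_zero hdim hJJ hJS hS hS0 hx'
    ext X
    -- By `hST` the image of T_{Su'} lies in ker S = im S, which T_{Su} kills.
    obtain ⟨w, hw⟩ := exists_eq_of_apply_eq_zero hdim hJJ hJS hS hS0
      (x := T (S u') X) (congrArg (· X) (hST u'))
    rw [ContinuousLinearMap.mul_def, ContinuousLinearMap.comp_apply, hw]
    exact congrArg (· w) (hTS u)

/-- The case `K² = -1` of the previous theorem. -/
theorem eq_zero_of_codazzi (hn : ∀ u, (∀ v, h u v = 0) → u = 0)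
    (hK : ∀ u v, h (K u) v = h u (K v)) (hT : ∀ u v w, h (T u v) w = h v (T u w))
    (hcod : ∀ u v, T u v = T v u) (hKK : K * K = -1)
    (hE : ∀ u, K * T u + T u * K = 0) : T = 0 := by
  have hKK' : ∀ a, K (K a) = -a := fun a => congrArg (· a) hKK
  have hE' : ∀ u v, T u (K v) = -K (T u v) := by
    intro u v
    have := congrArg (· v) (hE u)
    simp only [add_apply, ContinuousLinearMap.mul_def, ContinuousLinearMap.comp_apply,
      zero_apply] at this
    exact eq_neg_of_add_eq_zero_right this
  have left : ∀ u v, T (K u) v = -K (T u v) := fun u v => by rw [hcod, hE', hcod]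
  -- `left` gives T_{Ku} = -K T_u, whereas taking adjoints gives T_{Ku} = +K T_u; hence K T_u = 0.
  have hKT : ∀ u v, K (T u v) = 0 := by
    intro u v
    apply hn
    intro w
    have h1 : h (T (K u) v) w = h (K (T u v)) w := by
      rw [hT, left, map_neg, ← hK, ← hT, hE', map_neg, neg_apply, neg_neg]
    rw [left, map_neg, neg_apply] at h1
    linarith
  ext u v
  have := hKK' (T u v)
  rw [hKT, map_zero] at this
  exact neg_eq_zero.1 this.symm

/-- If `Ω w = h(n', w) n - h(n, w) n'` with `n' = K n` and `K n' = -n`, then `[κ Ω, K]` commutes with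
`K` only if `κ = 0`. -/
theorem eq_zero_of_double_commutator (hn : ∀ u, (∀ v, h u v = 0) → u = 0)
    (hK : ∀ u v, h (K u) v = h u (K v)) {n : E} (hn0 : n ≠ 0) (hKK : K (K n) = -n) {κ : ℝ}
    {R : E → E} (hR : ∀ w, R w = κ • (h (K n) w • n - h n w • K n))
    (hcomm : ∀ w, R (K (K w)) - K (R (K w)) = K (R (K w) - K (R w))) : κ = 0 := by
  by_contra hκ
  apply hn0
  apply hn
  intro w
  have key := hcomm w
  simp only [hR, map_smul, map_sub, hKK, ← hK, map_neg, neg_apply] at key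
  -- The operator Ω = ⟨Kn, ·⟩n - ⟨n, ·⟩Kn satisfies ΩK = -KΩ and K²Ω = -Ω, so [[Ω, K], K] = -4Ω.
  have key2 : (4 * κ) • (h (K n) w • n - h n w • K n) = 0 := by
    rw [← sub_eq_zero] at key
    rw [← neg_eq_zero, ← key]
    module
  have key3 := (smul_eq_zero.1 key2).resolve_left (by simpa using hκ)
  have key4 := congrArg K key3
  simp only [map_sub, map_smul, hKK, map_zero] at key4
  by_contra hw
  apply hn0
  have : (h (K n) w ^ 2 + h n w ^ 2) • n = 0 := by
    have : (h (K n) w ^ 2 + h n w ^ 2) • n = h (K n) w • (h (K n) w • n - h n w • K n)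
        + h n w • (h (K n) w • K n - h n w • -n) := by module
    rw [this, key3, key4]
    simp
  refine (smul_eq_zero.1 this).resolve_left ?_
  positivity

end Algebra

/-! ### Fields of endomorphisms -/

variable {E : Type*} [NormedAddCommGroup E] [NormedSpace ℝ E]

section CovDerivEnd

variable {Γ : E → E →L[ℝ] E →L[ℝ] E} {B C : E → E →L[ℝ] E} {y : E}

theorem covDerivEnd_congr (h : B =ᶠ[nhds y] C) : covDerivEnd Γ B y = covDerivEnd Γ C y := by
  rw [covDerivEnd, covDerivEnd, h.fderiv_eq, h.eq_of_nhds]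

theorem covDerivEnd_zero : covDerivEnd Γ (fun _ => 0) y = 0 := by
  ext u
  simp [covDerivEnd_apply]

theorem covDerivEnd_one : covDerivEnd Γ (fun _ => 1) y = 0 := by
  ext u
  simp [covDerivEnd_apply]

theorem covDerivEnd_add (hB : DifferentiableAt ℝ B y) (hC : DifferentiableAt ℝ C y) :
    covDerivEnd Γ (fun z => B z + C z) y = covDerivEnd Γ B y + covDerivEnd Γ C y := by
  ext1 u
  simp only [covDerivEnd_apply, fderiv_fun_add hB hC, add_apply]
  noncomm_ring

theorem covDerivEnd_sub (hB : DifferentiableAt ℝ B y) (hC : DifferentiableAt ℝ C y) :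
    covDerivEnd Γ (fun z => B z - C z) y = covDerivEnd Γ B y - covDerivEnd Γ C y := by
  ext1 u
  simp only [covDerivEnd_apply, fderiv_fun_sub hB hC, sub_apply]
  noncomm_ring

theorem covDerivEnd_const_smul (a : ℝ) (hB : DifferentiableAt ℝ B y) :
    covDerivEnd Γ (fun z => a • B z) y = a • covDerivEnd Γ B y := by
  ext1 u
  simp only [covDerivEnd_apply, fderiv_fun_const_smul hB, smul_apply, mul_smul_comm,
    smul_mul_assoc]
  module

theorem fderiv_mul_end (hB : DifferentiableAt ℝ B y) (hC : DifferentiableAt ℝ C y) (u : E) :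
    fderiv ℝ (fun z => B z * C z) y u = fderiv ℝ B y u * C y + B y * fderiv ℝ C y u := by
  have := (hB.hasFDerivAt.clm_comp hC.hasFDerivAt).fderiv
  simp only [ContinuousLinearMap.mul_def, this]
  simp
  abel

theorem covDerivEnd_mul (hB : DifferentiableAt ℝ B y) (hC : DifferentiableAt ℝ C y) (u : E) :
    covDerivEnd Γ (fun z => B z * C z) y u =
      covDerivEnd Γ B y u * C y + B y * covDerivEnd Γ C y u := by
  simp only [covDerivEnd_apply, fderiv_mul_end hB hC]
  noncomm_ring

theorem contDiffAt_covDerivEnd (hΓ : ContDiffAt ℝ ∞ Γ y) (hB : ContDiffAt ℝ ∞ B y) :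
    ContDiffAt ℝ ∞ (covDerivEnd Γ B) y := by
  have h1 := (ContinuousLinearMap.compL ℝ E E E).contDiff.contDiffAt.comp y hB
  have h2 := (ContinuousLinearMap.compL ℝ E E E).flip.contDiff.contDiffAt.comp y hB
  exact ((contDiffAt_fderiv hB).add (h1.clm_comp hΓ.neg)).add (h2.clm_comp hΓ)

/-- The Ricci identity for fields of endomorphisms. -/
theorem covDerivEnd_comm [FiniteDimensional ℝ E] {h : E → E →L[ℝ] E →L[ℝ] ℝ} {U : Set E}
    (hh : IsLocalMetric h U) (hy : y ∈ U) (hB : ContDiffAt ℝ ∞ B y) (u v w : E) :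
    (covDerivEnd (christoffel h) (fun z => covDerivEnd (christoffel h) B z v) y u
      - covDerivEnd (christoffel h) (fun z => covDerivEnd (christoffel h) B z u) y v) w =
    curvature h y u v (B y w) - B y (curvature h y u v w) := by
  have hΓ := hh.differentiableAt_christoffel hy
  have hB' := hB.differentiableAt (by simp)
  have hdB : DifferentiableAt ℝ (fderiv ℝ B) y := (contDiffAt_fderiv hB).differentiableAt (by simp)
  have hΓv : ∀ v, DifferentiableAt ℝ (fun z => christoffel h z v) y := fun v => by fun_prop
  have key : ∀ a b, fderiv ℝ (fun z => covDerivEnd (christoffel h) B z b) y a =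
      fderiv ℝ (fderiv ℝ B) y a b
        + (fderiv ℝ (christoffel h) y a b * B y + christoffel h y b * fderiv ℝ B y a)
        - (fderiv ℝ B y a * christoffel h y b + B y * fderiv ℝ (christoffel h) y a b) := by
    intro a b
    have h1 : DifferentiableAt ℝ (fun z => christoffel h z b * B z) y := (hΓv b).clm_comp hB'
    have h2 : DifferentiableAt ℝ (fun z => B z * christoffel h z b) y := hB'.clm_comp (hΓv b)
    simp only [covDerivEnd_apply]
    rw [fderiv_fun_sub (DifferentiableAt.fun_add (by fun_prop) h1) h2,
      fderiv_fun_add (by fun_prop) h1, sub_apply, add_apply, fderiv_mul_end (hΓv b) hB',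
      fderiv_mul_end hB' (hΓv b), fderiv_clm_apply_const hdB, fderiv_clm_apply_const hΓ]
  rw [covDerivEnd_apply, key, covDerivEnd_apply _ (fun z => covDerivEnd (christoffel h) B z u), key,
    fderiv_fderiv_comm hB v u,
    hh.curvature_eq hy, hh.curvature_eq hy]
  simp only [covDerivEnd_apply, ContinuousLinearMap.mul_def, ContinuousLinearMap.comp_apply,
    sub_apply, add_apply, map_sub, map_add]
  abel

end CovDerivEnd

/-- Let `K` be a self-adjoint Codazzi field of endomorphisms of a four-dimensional space with
`(K² + 1)² = 0`. Then the curvature operator of some nonzero plane `n, K n` with `K² n = -n` has a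
commutator with `K` that commutes with `K`. -/
theorem exists_curvature_double_commutator [FiniteDimensional ℝ E]
    {h : E → E →L[ℝ] E →L[ℝ] ℝ} {U : Set E} (hdim : Module.finrank ℝ E = 4)
    (hh : IsLocalMetric h U) (hU : U.Nonempty) {K : E → E →L[ℝ] E}
    (hKs : ∀ y ∈ U, ContDiffAt ℝ ∞ K y) (hsa : ∀ y ∈ U, ∀ u v, h y (K y u) v = h y u (K y v))
    (hcod : ∀ y ∈ U, ∀ u v,
      covDerivEnd (christoffel h) K y u v = covDerivEnd (christoffel h) K y v u)
    (hK : ∀ y ∈ U, (K y * K y + 1) * (K y * K y + 1) = 0) :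
    ∃ y ∈ U, ∃ n : E, n ≠ 0 ∧ K y (K y n) = -n ∧ ∀ w,
      curvature h y n (K y n) (K y (K y w)) - K y (curvature h y n (K y n) (K y w)) =
        K y (curvature h y n (K y n) (K y w) - K y (curvature h y n (K y n) w)) := by
  set T := covDerivEnd (christoffel h) K with hTdef
  let S : E → E →L[ℝ] E := fun z => K z * K z + 1
  have hKd : ∀ y ∈ U, DifferentiableAt ℝ K y := fun y hy => (hKs y hy).differentiableAt (by simp)
  have hKKd : ∀ y ∈ U, DifferentiableAt ℝ (fun z => K z * K z) y := fun y hy =>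
    (hKd y hy).clm_comp (hKd y hy)
  have hSd : ∀ y ∈ U, DifferentiableAt ℝ S y := fun y hy => (hKKd y hy).add (by fun_prop)
  have hDS : ∀ y ∈ U, ∀ u, covDerivEnd (christoffel h) S y u = K y * T y u + T y u * K y := by
    intro y hy u
    rw [covDerivEnd_add (hKKd y hy) (by fun_prop), covDerivEnd_one, add_zero,
      covDerivEnd_mul (hKd y hy) (hKd y hy), add_comm]
  have hTsa : ∀ y ∈ U, ∀ u v w, h y (T y u v) w = h y v (T y u w) := fun y hy =>
    hh.inner_covDerivEnd_comm hsa hy (hKd y hy)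
  have hTd : ∀ y ∈ U, DifferentiableAt ℝ T y := fun y hy =>
    (contDiffAt_covDerivEnd (hh.contDiffAt_christoffel hy) (hKs y hy)).differentiableAt (by simp)
  clear_value T
  -- If K² = -1 throughout `U`, then K is parallel and commutes with the curvature. Otherwise a
  -- single point with S ≠ 0 suffices, as this condition is open.
  by_cases hS0 : ∀ y ∈ U, S y = 0
  · have hKK : ∀ y ∈ U, K y * K y = -1 := fun y hy => eq_neg_of_add_eq_zero_left (hS0 y hy)
    have hT0 : ∀ y ∈ U, T y = 0 := by
      intro y hy
      refine eq_zero_of_codazzi (hh.nondegenerate y hy) (hsa y hy) (hTsa y hy) (hcod y hy)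
        (hKK y hy) fun u => ?_
      have : S =ᶠ[nhds y] fun _ => 0 := by
        filter_upwards [hh.mem_nhds hy] with z hz using hS0 z hz
      rw [← hDS y hy, covDerivEnd_congr this, covDerivEnd_zero, zero_apply]
    obtain ⟨y, hy⟩ := hU
    have : Nontrivial E := Module.nontrivial_of_finrank_pos (R := ℝ) (by omega)
    obtain ⟨n, hn⟩ := exists_ne (0 : E)
    refine ⟨y, hy, n, hn, congrArg (· n) (hKK y hy), fun w => ?_⟩
    have hDT : ∀ v, covDerivEnd (christoffel h) (fun z => T z v) y = 0 := by
      intro v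
      have : (fun z => T z v) =ᶠ[nhds y] fun _ => 0 := by
        filter_upwards [hh.mem_nhds hy] with z hz
        rw [hT0 z hz, zero_apply]
      rw [covDerivEnd_congr this, covDerivEnd_zero]
    have hcomm : ∀ w, curvature h y n (K y n) (K y w) - K y (curvature h y n (K y n) w) = 0 := by
      intro w
      rw [← covDerivEnd_comm hh hy (hKs y hy), ← hTdef, hDT, hDT]
      simp
    rw [hcomm, hcomm, map_zero]
  · push Not at hS0
    obtain ⟨y, hy, hSy⟩ := hS0
    have hSne : ∀ᶠ z in nhds y, z ∈ U ∧ S z ≠ 0 :=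
      Filter.Eventually.and (hh.mem_nhds hy) ((hSd y hy).continuousAt.eventually_ne hSy)
    have hDSS : ∀ z ∈ U, ∀ u,
        S z * (K z * T z u + T z u * K z) + (K z * T z u + T z u * K z) * S z = 0 := by
      intro z hz u
      have h0 : (fun z => S z * S z) =ᶠ[nhds z] fun _ => 0 := by
        filter_upwards [hh.mem_nhds hz] with x hx using hK x hx
      rw [← hDS z hz, add_comm, ← covDerivEnd_mul (hSd z hz) (hSd z hz), covDerivEnd_congr h0,
        covDerivEnd_zero, zero_apply]
    have hcomm : ∀ z ∈ U, S z ≠ 0 → ∀ x, S z x = 0 → K z * T z x = T z x * K z ∧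
        S z * T z x = 0 ∧ ∀ x', S z x' = 0 → T z x * T z x' = 0 := fun z hz hSz x hx =>
      commute_of_codazzi hdim (hh.symm z hz) (hh.nondegenerate z hz) (hsa z hz) (hTsa z hz)
        (hcod z hz) rfl (hK z hz) hSz (hDSS z hz) hx
    have hSS : ∀ z ∈ U, ∀ a, S z (S z a) = 0 := fun z hz a => congrArg (· a) (hK z hz)
    have hSK : S y * K y = K y * S y := by simp only [S]; noncomm_ring
    have hSK' : ∀ a, S y (K y a) = K y (S y a) := fun a => congrArg (· a) hSK
    have hKd' := hKd y hy
    -- The bracket is the second covariant derivative of K in the directions n and Sa, both in ker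
    -- S; it commutes with K.
    have main : ∀ a n, S y n = 0 →
        K y * (covDerivEnd (christoffel h) (fun z => T z (S y a)) y n
            - T y (christoffel h y n (S y a))) =
          (covDerivEnd (christoffel h) (fun z => T z (S y a)) y n
            - T y (christoffel h y n (S y a))) * K y := by
      intro a n hn
      let B : E → E →L[ℝ] E := fun z => T z (S z a)
      have hBd : DifferentiableAt ℝ B y :=
        (hTd y hy).clm_apply ((hSd y hy).clm_apply (by fun_prop))
      have hL : (fun z => K z * B z - B z * K z) =ᶠ[nhds y] fun _ => 0 := by
        filter_upwards [hSne] with z hz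
        exact sub_eq_zero.2 (hcomm z hz.1 hz.2 _ (hSS z hz.1 a)).1
      -- Differentiating KB = BK along n produces also T_n B and B T_n; both vanish, leaving [K, ∇_n
      -- B] = 0.
      have hTT : T y n * B y = 0 := (hcomm y hy hSy n hn).2.2 _ (hSS y hy a)
      have hTT' : B y * T y n = 0 := (hcomm y hy hSy _ (hSS y hy a)).2.2 n hn
      have hDB : K y * covDerivEnd (christoffel h) B y n =
          covDerivEnd (christoffel h) B y n * K y := by
        have h0 := congrArg (· n) (covDerivEnd_congr (Γ := christoffel h) hL)
        simp only [covDerivEnd_zero, zero_apply] at h0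
        rw [covDerivEnd_sub (B := fun z => K z * B z) (C := fun z => B z * K z) (hKd'.clm_comp hBd) (hBd.clm_comp hKd'), sub_apply,
          covDerivEnd_mul hKd' hBd, covDerivEnd_mul hBd hKd', ← hTdef, hTT, hTT', zero_add,
          add_zero, sub_eq_zero] at h0
        exact h0
      -- ∇_n S = K T_n + T_n K takes values in ker S since S T_n = 0, so T in the direction (∇_n S)a
      -- commutes with K.
      have hx₁ : S y (covDerivEnd (christoffel h) S y n a) = 0 := by
        have h0 : ∀ x, S y (T y n x) = 0 := fun x => congrArg (· x) (hcomm y hy hSy n hn).2.1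
        rw [hDS y hy]
        simp only [add_apply, ContinuousLinearMap.mul_def, ContinuousLinearMap.comp_apply, map_add,
          hSK', h0, map_zero, add_zero]
      -- Leibniz rule for B = T_{Sa}: its derivative splits into the second derivative of K and T in
      -- the directions (∇_n S)a and SΓ(n, a), all of which lie in ker S.
      have hexp : covDerivEnd (christoffel h) (fun z => T z (S y a)) y n
            - T y (christoffel h y n (S y a)) =
          covDerivEnd (christoffel h) B y n - T y (covDerivEnd (christoffel h) S y n a)
            - T y (S y (christoffel h y n a)) := by
        have h0 : fderiv ℝ B y n = fderiv ℝ T y n (S y a) + T y (fderiv ℝ S y n a) := by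
          rw [fderiv_clm_apply (hTd y hy) ((hSd y hy).clm_apply (by fun_prop)), add_apply,
            ContinuousLinearMap.comp_apply, fderiv_clm_apply_const (hSd y hy), add_comm]
          rfl
        rw [covDerivEnd_apply, covDerivEnd_apply, covDerivEnd_apply, h0,
          fderiv_clm_apply_const (hTd y hy)]
        simp only [sub_apply, add_apply, ContinuousLinearMap.mul_def,
          ContinuousLinearMap.comp_apply, map_sub, map_add, B]
        abel
      rw [hexp, mul_sub, mul_sub, sub_mul, sub_mul, hDB, (hcomm y hy hSy _ hx₁).1,
        (hcomm y hy hSy _ (hSS y hy _)).1]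
    obtain ⟨b, hb⟩ : ∃ b, S y b ≠ 0 := by
      by_contra! h0
      exact hSy (by ext a; simp [h0 a])
    refine ⟨y, hy, S y b, hb, ?_, fun w => ?_⟩
    · have := hSS y hy b
      exact eq_neg_of_add_eq_zero_left this
    · have hSKb : S y (K y (S y b)) = 0 := by rw [hSK', hSS y hy, map_zero]
      -- Both Sb and KSb = SKb lie in im S, so `main` applies to the two orders of differentiation.
      -- In the difference the Christoffel terms cancel and the Ricci identity leaves [R(Sb, KSb),
      -- K].
      have m1 := main b (K y (S y b)) hSKb
      have m2 := main (K y b) (S y b) (hSS y hy b)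
      rw [hSK', hh.christoffel_symm hy] at m2
      have m3 := congrArg (· w) (congrArg₂ (· - ·) m2 m1)
      simp only [← mul_sub, ← sub_mul, sub_sub_sub_cancel_right] at m3
      have m4 := covDerivEnd_comm hh hy (hKs y hy) (S y b) (K y (S y b))
      rw [← hTdef] at m4
      rw [← m4, ← m4]
      exact m3.symm

section

variable {E : Type*} [NormedAddCommGroup E] [NormedSpace ℝ E] [FiniteDimensional ℝ E]

theorem fderiv_trace {A : E → E →L[ℝ] E} {y : E} (hA : DifferentiableAt ℝ A y) (w : E) :
    fderiv ℝ (fun z => LinearMap.trace ℝ E (A z).toLinearMap) y w =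
      LinearMap.trace ℝ E (fderiv ℝ A y w).toLinearMap := by
  let L : (E →L[ℝ] E) →L[ℝ] ℝ :=
    LinearMap.toContinuousLinearMap (LinearMap.trace ℝ E ∘ₗ ContinuousLinearMap.coeLM ℝ)
  exact congrArg (· w) (L.hasFDerivAt.comp y hA.hasFDerivAt).fderiv

theorem contDiffAt_trace {A : E → E →L[ℝ] E} {y : E} (hA : ContDiffAt ℝ ∞ A y) :
    ContDiffAt ℝ ∞ (fun z => LinearMap.trace ℝ E (A z).toLinearMap) y := by
  let L : (E →L[ℝ] E) →L[ℝ] ℝ :=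
    LinearMap.toContinuousLinearMap (LinearMap.trace ℝ E ∘ₗ ContinuousLinearMap.coeLM ℝ)
  exact L.contDiff.contDiffAt.comp y hA

end

/-! ### Cartan's identity, constancy of the mean curvature, and the trace of A². -/

namespace IsLocalHypersurface

section General

variable {E F : Type*} [NormedAddCommGroup E] [NormedSpace ℝ E]
  [NormedAddCommGroup F] [NormedSpace ℝ F] [FiniteDimensional ℝ E] [FiniteDimensional ℝ F]
  {G : F → F →L[ℝ] F →L[ℝ] ℝ} {V : Set F} {f ν : E → F} {U : Set E} {ε : ℝ}

/-- Cartan's identity for a hypersurface of a five-dimensional space of constant curvature with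
two constant, complex conjugate principal curvatures `α ± i β`. -/
theorem cartan_identity (hf : IsLocalHypersurface G V f ν U ε) (hU : U.Nonempty)
    (hdim : Module.finrank ℝ E = 4) {c : ℝ}
    (hc : ∀ z ∈ V, ∀ u v w, curvature G z u v w = c • (G z v w • u - G z u w • v))
    {α β : ℝ} (hβ : β ≠ 0)
    (hA : ∀ y ∈ U, ((shapeOp G f ν y - α • (1 : E →L[ℝ] E)) * (shapeOp G f ν y - α • 1)
        + β ^ 2 • 1) * ((shapeOp G f ν y - α • 1) * (shapeOp G f ν y - α • 1) + β ^ 2 • 1) = 0) :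
    c + ε * (α ^ 2 + β ^ 2) = 0 := by
  have hh := hf.isLocalMetric_pullbackMetric
  set A := shapeOp G f ν with hAdef
  set h := pullbackMetric G f with hhdef
  have hone : ∀ u : E, (1 : E →L[ℝ] E) u = u := fun _ => rfl
  -- Normalized so that the eigenvalues are ± i. As α and β are constants, K is Codazzi along with
  -- A.
  let K : E → E →L[ℝ] E := fun y => β⁻¹ • (A y - α • 1)
  have hKs : ∀ y ∈ U, ContDiffAt ℝ ∞ K y := fun y hy =>
    ((hf.contDiffAt_shapeOp hy).sub contDiffAt_const).const_smul _
  have hAd : ∀ y ∈ U, DifferentiableAt ℝ (fun z => A z - α • (1 : E →L[ℝ] E)) y := fun y hy =>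
    (hf.differentiableAt_shapeOp hy).sub (by fun_prop)
  have hsa : ∀ y ∈ U, ∀ u v, h y (K y u) v = h y u (K y v) := by
    intro y hy u v
    have := hf.inner_shapeOp_comm hy u v
    simp only [K, smul_apply, sub_apply, hone, map_smul, map_sub,
      hhdef, hAdef, this]
  have hDK : ∀ y ∈ U, ∀ u, covDerivEnd (christoffel h) K y u =
      β⁻¹ • covDerivEnd (christoffel h) A y u := by
    intro y hy u
    rw [covDerivEnd_const_smul _ (hAd y hy),
      covDerivEnd_sub (hf.differentiableAt_shapeOp hy) (by fun_prop),
      covDerivEnd_const_smul _ (by fun_prop), covDerivEnd_one, smul_zero, sub_zero, smul_apply]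
  have hcod : ∀ y ∈ U, ∀ u v,
      covDerivEnd (christoffel h) K y u v = covDerivEnd (christoffel h) K y v u := by
    intro y hy u v
    rw [hDK y hy, hDK y hy, smul_apply, smul_apply, hf.codazzi hy hc]
  have hKK : ∀ y ∈ U, (K y * K y + 1) * (K y * K y + 1) = 0 := by
    intro y hy
    have : K y * K y + 1 = (β⁻¹ ^ 2) • ((A y - α • 1) * (A y - α • 1) + β ^ 2 • 1) := by
      have h1 : β⁻¹ ^ 2 * β ^ 2 = 1 := by rw [← mul_pow, inv_mul_cancel₀ hβ, one_pow]
      rw [smul_add, smul_smul, h1, one_smul, sq, ← smul_mul_smul_comm]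
    rw [this, smul_mul_smul_comm, hA y hy, smul_zero]
  obtain ⟨y, hy, n, hn, hKn, hcomm⟩ :=
    exists_curvature_double_commutator hdim hh hU hKs hsa hcod hKK
  refine eq_zero_of_double_commutator (hh.nondegenerate y hy) (hsa y hy) hn hKn
    (R := curvature h y n (K y n)) (fun w => ?_) hcomm
  have hAK : ∀ u, A y u = α • u + β • K y u := by
    intro u
    simp only [K, smul_apply, sub_apply, smul_smul, mul_inv_cancel₀ hβ,
      hone]
    module
  -- With An = αn + βKn and AKn = αKn - βn one has An ∧ AKn = (α² + β²) n ∧ Kn, whence the factor c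
  -- + ε(α² + β²).
  rw [hf.gauss_equation hy hc, ← hhdef, ← hAdef, hAK, hAK, hKn]
  simp only [map_add, map_smul, map_neg, add_apply, smul_apply, neg_apply, smul_eq_mul]
  module

end General

/-- If the mean curvature vector field is proper, and the shape operator has no real eigenvalue,
then the mean curvature is constant. -/
theorem fderiv_meanCurvature_eq_zero {n m : ℕ} {G : Coord n → Coord n →L[ℝ] Coord n →L[ℝ] ℝ}
    {V : Set (Coord n)} {f ν : Coord m → Coord n} {U : Set (Coord m)} {ε : ℝ}
    (hf : IsLocalHypersurface G V f ν U ε) {y : Coord m} (hy : y ∈ U) {c : ℝ}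
    (hc : ∀ z ∈ V, ∀ u v w, curvature G z u v w = c • (G z v w • u - G z u w • v))
    {φ : Coord m → ℝ} {a : ℝ} (ha : a ≠ 0)
    (hφ : ∀ z ∈ U, φ z = a * LinearMap.trace ℝ (Coord m) (shapeOp G f ν z).toLinearMap)
    {lam : ℝ} (hlap : laplacian G f (fun z => φ z • ν z) y = lam • ν y)
    (hev : ∀ (r : ℝ) (v : Coord m), shapeOp G f ν y v = r • v → v = 0) :
    fderiv ℝ φ y = 0 := by
  have hφ' : ∀ z ∈ U, φ =ᶠ[nhds z]
      fun z => a * LinearMap.trace ℝ (Coord m) (shapeOp G f ν z).toLinearMap := fun z hz => by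
    filter_upwards [hf.mem_nhds hz] with x hx using hφ x hx
  have hφs : ∀ z ∈ U, ContDiffAt ℝ ∞ φ z := fun z hz =>
    (contDiffAt_const.mul (contDiffAt_trace (hf.contDiffAt_shapeOp hz))).congr_of_eventuallyEq
      (hφ' z hz)
  have hdφ : ∀ w, fderiv ℝ φ y w =
      a * LinearMap.trace ℝ (Coord m) (fderiv ℝ (shapeOp G f ν) y w).toLinearMap := by
    intro w
    rw [(hφ' y hy).fderiv_eq, ← fderiv_trace (hf.differentiableAt_shapeOp hy),
      fderiv_const_mul ((contDiffAt_trace (hf.contDiffAt_shapeOp hy)).differentiableAt (by simp))]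
    simp
  -- The Laplacian is normal, so its tangential part 2dφ(Aw) + φ tr(∂_w A) is zero; moreover tr(∂_w
  -- A) = dφ(w)/a.
  have htan : ∀ w, fderiv ℝ φ y (shapeOp G f ν y w + (φ y / (2 * a)) • w) = 0 := by
    intro w
    have h1 := hf.inner_laplacian_fderiv hy hφs hc w
    rw [hlap, map_smul, smul_apply, hf.normal y hy, smul_zero] at h1
    rw [map_add, map_smul, hdφ w, smul_eq_mul]
    field_simp
    linarith
  -- A kernel vector of `B` would be an eigenvector of A for the real eigenvalue -φ/(2a); so `B` is
  -- onto and dφ = 0.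
  let B : Coord m →ₗ[ℝ] Coord m := (shapeOp G f ν y).toLinearMap + (φ y / (2 * a)) • LinearMap.id
  have hB : Function.Injective B := by
    rw [injective_iff_map_eq_zero]
    intro v hv
    refine hev (-(φ y / (2 * a))) v ?_
    rw [neg_smul]
    exact eq_neg_of_add_eq_zero_left hv
  ext w
  obtain ⟨v, rfl⟩ := LinearMap.injective_iff_surjective.1 hB w
  exact htan v

/-- The trace of the squared shape operator of a hypersurface with constant mean curvature and
proper mean curvature vector field. -/
theorem trace_sq_shapeOp {n m : ℕ} {G : Coord n → Coord n →L[ℝ] Coord n →L[ℝ] ℝ}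
    {V : Set (Coord n)} {f ν : Coord m → Coord n} {U : Set (Coord m)} {ε : ℝ}
    (hf : IsLocalHypersurface G V f ν U ε) {y : Coord m} (hy : y ∈ U) {H lam : ℝ} (hH : H ≠ 0)
    (hlap : laplacian G f (fun z => H • ν z) y = lam • H • ν y) :
    LinearMap.trace ℝ (Coord m) (shapeOp G f ν y ∘L shapeOp G f ν y).toLinearMap = ε * lam := by
  have h1 := hf.inner_laplacian_normal hy (φ := fun _ => H) (fun _ _ => contDiffAt_const)
    (by simp)
  rw [hlap, map_smul, map_smul, smul_apply, smul_apply, hf.inner_self y hy, smul_eq_mul,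
    smul_eq_mul] at h1
  apply mul_left_cancel₀ hH
  linarith

end IsLocalHypersurface

/-! ### Naturality -/

section Naturality

variable {E F : Type*} [NormedAddCommGroup E] [NormedSpace ℝ E]
  [NormedAddCommGroup F] [NormedSpace ℝ F] [FiniteDimensional ℝ E] [FiniteDimensional ℝ F]
  {G₀ G₁ : F → F →L[ℝ] F →L[ℝ] ℝ} {V₀ V₁ : Set F} {σ : F → F}

/-- The transformation law of Christoffel symbols under local isometries. -/
theorem fderiv_christoffel_of_isometry (hG₀ : IsLocalMetric G₀ V₀) (hG₁ : IsLocalMetric G₁ V₁)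
    {z : F} (hz : z ∈ V₀) (hσz : σ z ∈ V₁) (hσ : ContDiffAt ℝ ∞ σ z)
    (hiso : G₀ =ᶠ[nhds z] pullbackMetric G₁ σ) (u v : F) :
    fderiv ℝ σ z (christoffel G₀ z u v) =
      christoffel G₁ (σ z) (fderiv ℝ σ z u) (fderiv ℝ σ z v) + fderiv ℝ (fderiv ℝ σ) z u v := by
  have hval : ∀ a b, G₀ z a b = G₁ (σ z) (fderiv ℝ σ z a) (fderiv ℝ σ z b) := fun a b => by
    rw [hiso.eq_of_nhds, pullbackMetric_apply]
  have hinj : Function.Injective (fderiv ℝ σ z).toLinearMap := by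
    rw [injective_iff_map_eq_zero]
    intro a ha
    refine hG₀.nondegenerate z hz a fun b => ?_
    rw [hval, show fderiv ℝ σ z a = 0 from ha, map_zero, zero_apply]
  apply hG₁.ext_inner hσz
  intro w
  obtain ⟨w, rfl⟩ := LinearMap.injective_iff_surjective.1 hinj w
  have hk : koszul G₀ z = koszul (pullbackMetric G₁ σ) z := by
    simp only [koszul, hiso.fderiv_eq]
  rw [ContinuousLinearMap.coe_coe, ← hval, hG₀.inner_christoffel hz, hk,
    koszul_pullbackMetric hG₁ hσz hσ, map_add, add_apply, hG₁.inner_christoffel hσz]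

variable {f₀ f₁ s₀ s₁ : E → F} {τ : E → E} {y : E}

-- The second derivative of σ in the transformation law of the Christoffel symbols cancels the one
-- produced by differentiating dσ(s₀).
omit [FiniteDimensional ℝ E] in
theorem fderiv_covDerivAlong_of_isometry (hG₀ : IsLocalMetric G₀ V₀) (hG₁ : IsLocalMetric G₁ V₁)
    (hy : f₀ y ∈ V₀) (hσy : σ (f₀ y) ∈ V₁) (hσ : ContDiffAt ℝ ∞ σ (f₀ y))
    (hiso : G₀ =ᶠ[nhds (f₀ y)] pullbackMetric G₁ σ)
    (hf₀ : DifferentiableAt ℝ f₀ y) (hf₁ : DifferentiableAt ℝ f₁ (τ y))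
    (hs₀ : DifferentiableAt ℝ s₀ y) (hs₁ : DifferentiableAt ℝ s₁ (τ y))
    (hτ : DifferentiableAt ℝ τ y) (hf : σ ∘ f₀ =ᶠ[nhds y] f₁ ∘ τ)
    (hs : (fun z => fderiv ℝ σ (f₀ z) (s₀ z)) =ᶠ[nhds y] s₁ ∘ τ) (u : E) :
    fderiv ℝ σ (f₀ y) (covDerivAlong G₀ f₀ s₀ y u) =
      covDerivAlong G₁ f₁ s₁ (τ y) (fderiv ℝ τ y u) := by
  have hσ' := hσ.differentiableAt (by simp)
  have hdσ : DifferentiableAt ℝ (fderiv ℝ σ) (f₀ y) :=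
    (contDiffAt_fderiv hσ).differentiableAt (by simp)
  have hdf : fderiv ℝ σ (f₀ y) (fderiv ℝ f₀ y u) = fderiv ℝ f₁ (τ y) (fderiv ℝ τ y u) := by
    have := Filter.EventuallyEq.fderiv_eq (𝕜 := ℝ) hf
    rw [fderiv_comp y hσ' hf₀, fderiv_comp y hf₁ hτ] at this
    exact congrArg (fun L : E →L[ℝ] F => L u) this
  have hds : fderiv ℝ (fderiv ℝ σ) (f₀ y) (fderiv ℝ f₀ y u) (s₀ y)
      + fderiv ℝ σ (f₀ y) (fderiv ℝ s₀ y u) = fderiv ℝ s₁ (τ y) (fderiv ℝ τ y u) := by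
    have := Filter.EventuallyEq.fderiv_eq (𝕜 := ℝ) hs
    rw [fderiv_comp y hs₁ hτ, fderiv_clm_apply (c := fun z => fderiv ℝ σ (f₀ z)) (hdσ.comp y hf₀) hs₀,
      fderiv_fun_comp y hdσ hf₀] at this
    have := congrArg (fun L : E →L[ℝ] F => L u) this
    simp at this
    rw [← this]
    abel
  have hse := hs.eq_of_nhds
  have hfe := hf.eq_of_nhds
  simp only [Function.comp_apply] at hse hfe
  rw [covDerivAlong_apply, covDerivAlong_apply, map_add,
    fderiv_christoffel_of_isometry hG₀ hG₁ hy hσy hσ hiso, hdf, hse, hfe, ← hds]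
  abel

/-- The shape operator is invariant under local isometries and reparametrizations. -/
theorem fderiv_shapeOp_of_isometry {ν₀ ν₁ : E → F} {U₀ U₁ : Set E} {ε : ℝ}
    (hf₀ : IsLocalHypersurface G₀ V₀ f₀ ν₀ U₀ ε) (hf₁ : IsLocalHypersurface G₁ V₁ f₁ ν₁ U₁ ε)
    (hy : y ∈ U₀) (hτy : τ y ∈ U₁) (hσ : ContDiffAt ℝ ∞ σ (f₀ y))
    (hiso : G₀ =ᶠ[nhds (f₀ y)] pullbackMetric G₁ σ) (hτ : DifferentiableAt ℝ τ y)
    (hf : σ ∘ f₀ =ᶠ[nhds y] f₁ ∘ τ)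
    (hν : (fun z => fderiv ℝ σ (f₀ z) (ν₀ z)) =ᶠ[nhds y] ν₁ ∘ τ) (u : E) :
    fderiv ℝ τ y (shapeOp G₀ f₀ ν₀ y u) = shapeOp G₁ f₁ ν₁ (τ y) (fderiv ℝ τ y u) := by
  have hfe : σ (f₀ y) = f₁ (τ y) := hf.eq_of_nhds
  have hdf : ∀ v, fderiv ℝ σ (f₀ y) (fderiv ℝ f₀ y v) = fderiv ℝ f₁ (τ y) (fderiv ℝ τ y v) := by
    intro v
    have := Filter.EventuallyEq.fderiv_eq (𝕜 := ℝ) hf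
    rw [fderiv_comp y (hσ.differentiableAt (by simp)) (hf₀.differentiableAt_map hy),
      fderiv_comp y (hf₁.differentiableAt_map hτy) hτ] at this
    exact congrArg (fun L : E →L[ℝ] F => L v) this
  have h := fderiv_covDerivAlong_of_isometry hf₀.metric hf₁.metric (hf₀.mapsTo hy)
    (hfe ▸ hf₁.mapsTo hτy) hσ hiso (hf₀.differentiableAt_map hy) (hf₁.differentiableAt_map hτy)
    (hf₀.differentiableAt_normal hy) (hf₁.differentiableAt_normal hτy) hτ hf hν u
  rw [hf₀.weingarten hy, hf₁.weingarten hτy, map_neg, neg_inj, hdf] at h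
  exact hf₁.fderiv_injective hτy h

end Naturality

end LocalGeometry

/-! ### Charts -/

section Charts

variable {n : ℕ} {N : Type*} [TopologicalSpace N] [ChartedSpace (EuclideanSpace ℝ (Fin n)) N]

/-- The derivative at `q` of the chart around `q₀`. -/
def chartDeriv (q₀ q : N) : Coord n →L[ℝ] Coord n :=
  mfderiv (𝓡 n) (𝓡 n) (extChartAt (𝓡 n) q₀) q

/-- The derivative at `z` of the inverse of the chart around `q₀`. -/
def chartSymmDeriv (q₀ : N) (z : Coord n) : Coord n →L[ℝ] Coord n :=
  mfderiv (𝓡 n) (𝓡 n) (extChartAt (𝓡 n) q₀).symm z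

variable [IsManifold (𝓡 n) ∞ N]

theorem chartDeriv_chartSymmDeriv {q₀ : N} {z : Coord n} (hz : z ∈ (extChartAt (𝓡 n) q₀).target)
    (v : Coord n) :
    chartDeriv q₀ ((extChartAt (𝓡 n) q₀).symm z) (chartSymmDeriv q₀ z v) = v := by
  have := mfderiv_extChartAt_comp_mfderivWithin_extChartAt_symm hz
  rw [ModelWithCorners.range_eq_univ, mfderivWithin_univ] at this
  exact congrArg (fun L : Coord n →L[ℝ] Coord n => L v) this

theorem chartSymmDeriv_chartDeriv {q₀ q : N} (hq : q ∈ (extChartAt (𝓡 n) q₀).source)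
    (v : Coord n) : chartSymmDeriv q₀ (extChartAt (𝓡 n) q₀ q) (chartDeriv q₀ q v) = v := by
  have := mfderivWithin_extChartAt_symm_comp_mfderiv_extChartAt' hq
  rw [ModelWithCorners.range_eq_univ, mfderivWithin_univ] at this
  exact congrArg (fun L : Coord n →L[ℝ] Coord n => L v) this

theorem chartDeriv_self (q : N) : chartDeriv q q = ContinuousLinearMap.id ℝ (Coord n) :=
  mfderiv_extChartAt_self

theorem mdifferentiableAt_extChartAt' {q₀ q : N} (hq : q ∈ (extChartAt (𝓡 n) q₀).source) :
    MDifferentiableAt (𝓡 n) (𝓡 n) (extChartAt (𝓡 n) q₀) q :=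
  mdifferentiableAt_extChartAt (by rwa [extChartAt_source] at hq)

theorem contMDiffAt_extChartAt_symm {q₀ : N} {z : Coord n}
    (hz : z ∈ (extChartAt (𝓡 n) q₀).target) :
    ContMDiffAt (𝓡 n) (𝓡 n) ∞ (extChartAt (𝓡 n) q₀).symm z :=
  (contMDiffOn_extChartAt_symm q₀).contMDiffAt ((isOpen_extChartAt_target q₀).mem_nhds hz)

theorem mdifferentiableAt_extChartAt_symm {q₀ : N} {z : Coord n}
    (hz : z ∈ (extChartAt (𝓡 n) q₀).target) :
    MDifferentiableAt (𝓡 n) (𝓡 n) (extChartAt (𝓡 n) q₀).symm z :=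
  (contMDiffAt_extChartAt_symm hz).mdifferentiableAt (by simp)

/-- The transition map from the chart around `q₀` to the chart around `q₁`. -/
def transition (q₀ q₁ : N) (z : Coord n) : Coord n :=
  extChartAt (𝓡 n) q₁ ((extChartAt (𝓡 n) q₀).symm z)

omit [IsManifold (𝓡 n) ∞ N] in
theorem extChartAt_symm_transition {q₀ q₁ : N} {z : Coord n}
    (hz' : (extChartAt (𝓡 n) q₀).symm z ∈ (extChartAt (𝓡 n) q₁).source) :
    (extChartAt (𝓡 n) q₁).symm (transition q₀ q₁ z) = (extChartAt (𝓡 n) q₀).symm z :=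
  (extChartAt (𝓡 n) q₁).left_inv hz'

section Transition

variable {q₀ q₁ : N} {z : Coord n} (hz : z ∈ (extChartAt (𝓡 n) q₀).target)
  (hz' : (extChartAt (𝓡 n) q₀).symm z ∈ (extChartAt (𝓡 n) q₁).source)

include hz hz'

theorem contDiffAt_transition : ContDiffAt ℝ ∞ (transition q₀ q₁) z := by
  rw [← contMDiffAt_iff_contDiffAt]
  exact ContMDiffAt.comp (I' := 𝓡 n) z
    (contMDiffAt_extChartAt' (by rwa [extChartAt_source] at hz')) (contMDiffAt_extChartAt_symm hz)

theorem fderiv_transition (v : Coord n) :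
    fderiv ℝ (transition q₀ q₁) z v =
      chartDeriv q₁ ((extChartAt (𝓡 n) q₀).symm z) (chartSymmDeriv q₀ z v) := by
  have := mfderiv_comp (I := 𝓡 n) (I' := 𝓡 n) (I'' := 𝓡 n) z (mdifferentiableAt_extChartAt' hz')
    (mdifferentiableAt_extChartAt_symm hz)
  rw [← mfderiv_eq_fderiv]
  exact congrArg (fun L : Coord n →L[ℝ] Coord n => L v) this

theorem eventually_transition : ∀ᶠ w in nhds z, w ∈ (extChartAt (𝓡 n) q₀).target ∧
    (extChartAt (𝓡 n) q₀).symm w ∈ (extChartAt (𝓡 n) q₁).source :=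
  Filter.Eventually.and ((isOpen_extChartAt_target q₀).mem_nhds hz)
    ((contMDiffAt_extChartAt_symm hz).continuousAt.preimage_mem_nhds
      ((isOpen_extChartAt_source q₁).mem_nhds hz'))

theorem chartSymmDeriv_transition (v : Coord n) :
    chartSymmDeriv q₁ (transition q₀ q₁ z) (fderiv ℝ (transition q₀ q₁) z v) =
      chartSymmDeriv q₀ z v := by
  rw [fderiv_transition hz hz']
  exact chartSymmDeriv_chartDeriv hz' _

theorem fderiv_transition_injective : Function.Injective (fderiv ℝ (transition q₀ q₁) z) := by
  intro u v huv
  have h := congrArg (chartSymmDeriv q₁ (transition q₀ q₁ z)) huv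
  rw [chartSymmDeriv_transition hz hz', chartSymmDeriv_transition hz hz'] at h
  rw [← chartDeriv_chartSymmDeriv hz u, h, chartDeriv_chartSymmDeriv hz]

end Transition

namespace PseudoRiemannianMetric

variable (g : PseudoRiemannianMetric n N)

/-- The metric on the fixed model of the tangent spaces. -/
def coordInner (q : N) : Coord n →L[ℝ] Coord n →L[ℝ] ℝ := g.inner q

omit [IsManifold (𝓡 n) ∞ N] in
theorem inChart_apply (q₀ : N) (z u v : Coord n) :
    g.inChart q₀ z u v = g.coordInner ((extChartAt (𝓡 n) q₀).symm z) (chartSymmDeriv q₀ z u)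
      (chartSymmDeriv q₀ z v) := rfl

theorem isLocalMetric_inChart (q₀ : N) :
    IsLocalMetric (g.inChart q₀) (extChartAt (𝓡 n) q₀).target where
  isOpen := isOpen_extChartAt_target q₀
  contDiffAt _ hz := (g.smooth q₀).contDiffAt ((isOpen_extChartAt_target q₀).mem_nhds hz)
  symm _ _ _ _ := g.symm _ _ _
  nondegenerate z hz u hu := by
    have h : chartSymmDeriv q₀ z u = 0 := by
      refine g.nondegenerate ((extChartAt (𝓡 n) q₀).symm z) _ fun v => ?_
      have h1 := hu (chartDeriv q₀ ((extChartAt (𝓡 n) q₀).symm z) v)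
      have h2 := chartSymmDeriv_chartDeriv ((extChartAt (𝓡 n) q₀).map_target hz) v
      rw [(extChartAt (𝓡 n) q₀).right_inv hz] at h2
      rw [inChart_apply, h2] at h1
      exact h1
    rw [← chartDeriv_chartSymmDeriv hz u, h, map_zero]

/-- Chart transitions are isometries of the coordinate metrics, so the naturality results apply to
them. -/
theorem inChart_eventuallyEq {q₀ q₁ : N} {z : Coord n} (hz : z ∈ (extChartAt (𝓡 n) q₀).target)
    (hz' : (extChartAt (𝓡 n) q₀).symm z ∈ (extChartAt (𝓡 n) q₁).source) :
    g.inChart q₀ =ᶠ[nhds z] pullbackMetric (g.inChart q₁) (transition q₀ q₁) := by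
  filter_upwards [eventually_transition hz hz'] with w hw
  ext u v
  rw [pullbackMetric_apply, inChart_apply, inChart_apply, chartSymmDeriv_transition hw.1 hw.2,
    chartSymmDeriv_transition hw.1 hw.2, extChartAt_symm_transition hw.2]

theorem HasConstantSectionalCurvature.curvature_eq {g : PseudoRiemannianMetric n N} {c : ℝ}
    (hc : g.HasConstantSectionalCurvature c) (hn : 2 ≤ n) (q₀ : N) :
    ∀ z ∈ (extChartAt (𝓡 n) q₀).target, ∀ u v w, curvature (g.inChart q₀) z u v w =
      c • (g.inChart q₀ z v w • u - g.inChart q₀ z u w • v) := fun z hz u v w =>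
  (g.isLocalMetric_inChart q₀).curvature_of_sectional hz (by simpa using hn) (hc q₀ z hz) u v w

end PseudoRiemannianMetric

end Charts

/-! ### Immersed hypersurfaces read in charts. -/

section Immersion

variable {m n : ℕ}
  {M : Type*} [TopologicalSpace M] [ChartedSpace (EuclideanSpace ℝ (Fin m)) M]
  [IsManifold (𝓡 m) ∞ M]
  {N : Type*} [TopologicalSpace N] [ChartedSpace (EuclideanSpace ℝ (Fin n)) N]
  [IsManifold (𝓡 n) ∞ N]
  {g : PseudoRiemannianMetric n N} {x : M → N} {ξ : ∀ p : M, TangentSpace (𝓡 n) (x p)} {ε : ℝ}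

/-- The domain of the coordinate expression of `x : M → N` near `p₀`. -/
def mapChartDomain (x : M → N) (p₀ : M) : Set (Coord m) :=
  (extChartAt (𝓡 m) p₀).target ∩
    (extChartAt (𝓡 m) p₀).symm ⁻¹' (x ⁻¹' (extChartAt (𝓡 n) (x p₀)).source)

omit [IsManifold (𝓡 m) ∞ M] [IsManifold (𝓡 n) ∞ N] in
theorem extChartAt_mem_mapChartDomain {p₀ p : M} (hp : p ∈ (extChartAt (𝓡 m) p₀).source)
    (hp' : x p ∈ (extChartAt (𝓡 n) (x p₀)).source) :
    extChartAt (𝓡 m) p₀ p ∈ mapChartDomain (n := n) x p₀ := by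
  refine ⟨(extChartAt (𝓡 m) p₀).map_source hp, ?_⟩
  rwa [Set.mem_preimage, (extChartAt (𝓡 m) p₀).left_inv hp]

omit [IsManifold (𝓡 m) ∞ M] [IsManifold (𝓡 n) ∞ N] in
theorem extChartAt_self_mem_mapChartDomain (p : M) :
    extChartAt (𝓡 m) p p ∈ mapChartDomain (n := n) x p :=
  extChartAt_mem_mapChartDomain (mem_extChartAt_source p) (mem_extChartAt_source (x p))

omit [IsManifold (𝓡 m) ∞ M] [IsManifold (𝓡 n) ∞ N] in
theorem isOpen_mapChartDomain (hx : Continuous x) (p₀ : M) :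
    IsOpen (mapChartDomain (m := m) (n := n) x p₀) :=
  (continuousOn_extChartAt_symm p₀).isOpen_inter_preimage (isOpen_extChartAt_target p₀)
    ((isOpen_extChartAt_source _).preimage hx)

/-- The derivative of `x`, on the fixed models of the tangent spaces. -/
def coordDeriv (m n : ℕ) {M : Type*} [TopologicalSpace M]
    [ChartedSpace (EuclideanSpace ℝ (Fin m)) M]
    {N : Type*} [TopologicalSpace N] [ChartedSpace (EuclideanSpace ℝ (Fin n)) N]
    (x : M → N) (p : M) : Coord m →L[ℝ] Coord n :=
  mfderiv (𝓡 m) (𝓡 n) x p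

theorem fderiv_mapInChart (hx : IsNondegenerateImmersion m g x) {p₀ : M} {y : Coord m}
    (hy : y ∈ mapChartDomain (n := n) x p₀) (v : Coord m) :
    fderiv ℝ (mapInChart (m := m) (n := n) x p₀) y v =
      chartDeriv (x p₀) (x ((extChartAt (𝓡 m) p₀).symm y))
        (coordDeriv m n x ((extChartAt (𝓡 m) p₀).symm y) (chartSymmDeriv p₀ y v)) := by
  have hxd := (hx.smooth ((extChartAt (𝓡 m) p₀).symm y)).mdifferentiableAt (by simp)
  have h1 := mfderiv_comp (I := 𝓡 m) (I' := 𝓡 m) (I'' := 𝓡 n) y hxd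
    (mdifferentiableAt_extChartAt_symm hy.1)
  have h2 := mfderiv_comp (I := 𝓡 m) (I' := 𝓡 n) (I'' := 𝓡 n) y
    (g := extChartAt (𝓡 n) (x p₀)) (f := x ∘ (extChartAt (𝓡 m) p₀).symm)
    (mdifferentiableAt_extChartAt' hy.2)
    (MDifferentiableAt.comp (I := 𝓡 m) (I' := 𝓡 m) (I'' := 𝓡 n) y hxd
      (mdifferentiableAt_extChartAt_symm hy.1))
  rw [h1] at h2
  rw [← mfderiv_eq_fderiv]
  exact congrArg (fun L : Coord m →L[ℝ] Coord n => L v) h2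

theorem inChart_fderiv_mapInChart (hx : IsNondegenerateImmersion m g x) {p₀ : M} {y : Coord m}
    (hy : y ∈ mapChartDomain (n := n) x p₀) (u : Coord n) (v : Coord m) :
    g.inChart (x p₀) (mapInChart x p₀ y)
        (chartDeriv (x p₀) (x ((extChartAt (𝓡 m) p₀).symm y)) u)
        (fderiv ℝ (mapInChart (m := m) (n := n) x p₀) y v) =
      g.coordInner (x ((extChartAt (𝓡 m) p₀).symm y)) u
        (coordDeriv m n x ((extChartAt (𝓡 m) p₀).symm y) (chartSymmDeriv p₀ y v)) := by
  rw [fderiv_mapInChart hx hy, PseudoRiemannianMetric.inChart_apply, mapInChart,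
    chartSymmDeriv_chartDeriv hy.2, chartSymmDeriv_chartDeriv hy.2,
    (extChartAt (𝓡 n) (x p₀)).left_inv hy.2]

/-- The coordinate expression of a hypersurface. -/
theorem isLocalHypersurface_inChart (hmn : n = m + 1) (hx : IsNondegenerateImmersion m g x)
    (hξ : IsUnitNormal m g x ξ ε) (p₀ : M) :
    IsLocalHypersurface (g.inChart (x p₀)) (extChartAt (𝓡 n) (x p₀)).target
      (mapInChart (m := m) x p₀) (fieldInChart x ξ p₀) (mapChartDomain (n := n) x p₀) ε where
  metric := g.isLocalMetric_inChart (x p₀)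
  isOpen := isOpen_mapChartDomain hx.smooth.continuous p₀
  mapsTo y hy := (extChartAt (𝓡 n) (x p₀)).map_source hy.2
  contDiffAt_map y hy := by
    rw [← contMDiffAt_iff_contDiffAt]
    have h1 := ContMDiffAt.comp (I' := 𝓡 m) y (hx.smooth ((extChartAt (𝓡 m) p₀).symm y))
      (contMDiffAt_extChartAt_symm hy.1)
    exact ContMDiffAt.comp (I' := 𝓡 n) y
      (contMDiffAt_extChartAt' (by simpa [extChartAt_source] using hy.2)) h1
  contDiffAt_normal y hy := by
    rw [← contMDiffAt_iff_contDiffAt]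
    have hM : IsManifold (𝓡 n) (∞ + 1) N := by simpa using ‹IsManifold (𝓡 n) ∞ N›
    let e := trivializationAt (Coord n) (TangentSpace (𝓡 n)) (x p₀)
    have hsrc : ∀ z ∈ mapChartDomain (n := n) x p₀,
        x ((extChartAt (𝓡 m) p₀).symm z) ∈ (chartAt (Coord n) (x p₀)).source := fun z hz => by
      simpa [extChartAt_source] using hz.2
    -- Smoothness of ξ as a map into the tangent bundle is read in the trivialization at x p₀, whose
    -- action on fibres is the derivative of the chart.
    have h1 := ((e.contMDiffAt_iff (n := ∞) (by
      rw [e.mem_source]; simpa [e] using hsrc y hy)).1 (hξ.smooth ((extChartAt (𝓡 m) p₀).symm y))).2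
    have h2 := ContMDiffAt.comp (I' := 𝓡 m) y h1 (contMDiffAt_extChartAt_symm hy.1)
    refine h2.congr_of_eventuallyEq ?_
    filter_upwards [(isOpen_mapChartDomain hx.smooth.continuous p₀).mem_nhds hy] with z hz
    have h3 := TangentBundle.continuousLinearMapAt_trivializationAt (I := 𝓡 n) (hsrc z hz)
    have h4 := e.continuousLinearMapAt_apply_of_mem ℝ (b := x ((extChartAt (𝓡 m) p₀).symm z))
      (by simpa [e] using hsrc z hz) (ξ ((extChartAt (𝓡 m) p₀).symm z))
    rw [h3] at h4
    exact h4
  normal y hy u := by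
    exact (inChart_fderiv_mapInChart hx hy (ξ ((extChartAt (𝓡 m) p₀).symm y)) u).trans
      (hξ.normal _ _)
  inner_self y hy := by
    rw [PseudoRiemannianMetric.inChart_apply]
    have h := chartSymmDeriv_chartDeriv hy.2 (ξ ((extChartAt (𝓡 m) p₀).symm y))
    have h1 : fieldInChart x ξ p₀ y = chartDeriv (x p₀) (x ((extChartAt (𝓡 m) p₀).symm y))
      (ξ ((extChartAt (𝓡 m) p₀).symm y)) := rfl
    rw [h1, mapInChart, h, (extChartAt (𝓡 n) (x p₀)).left_inv hy.2]
    exact hξ.inner_self _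
  sign := hξ.sign
  nondegenerate y hy u hu := by
    have h : chartSymmDeriv p₀ y u = 0 := by
      refine hx.nondegenerate ((extChartAt (𝓡 m) p₀).symm y) _ fun v => ?_
      have h1 := hu (chartDeriv p₀ ((extChartAt (𝓡 m) p₀).symm y) v)
      have h2 := chartSymmDeriv_chartDeriv ((extChartAt (𝓡 m) p₀).map_target hy.1) v
      rw [(extChartAt (𝓡 m) p₀).right_inv hy.1] at h2
      rw [pullbackMetric_apply, fderiv_mapInChart hx hy u, inChart_fderiv_mapInChart hx hy, h2]
        at h1
      exact h1
    rw [← chartDeriv_chartSymmDeriv hy.1 u, h, map_zero]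
  finrank_eq := by simp [hmn]

end Immersion

/-! ### Endomorphisms with two complex conjugate eigenvalues -/

section Endomorphisms

open Polynomial

theorem LinearMap.trace_eq_neg_nextCoeff_charpoly {K V : Type*} [Field K] [AddCommGroup V]
    [Module K V] [FiniteDimensional K V] [Nontrivial V] (A : V →ₗ[K] V) :
    LinearMap.trace K V A = -A.charpoly.nextCoeff := by
  rw [LinearMap.trace_eq_matrix_trace K (Module.finBasis K V),
    Matrix.trace_eq_neg_charpoly_nextCoeff, LinearMap.charpoly_toMatrix]

/-- A monic real quartic whose complex roots are two non-real numbers is a square. -/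
theorem Polynomial.exists_eq_quadratic_sq {P : ℝ[X]} (hP : P.Monic) (hdeg : P.natDegree = 4)
    (hcard : {μ : ℂ | (P.map (algebraMap ℝ ℂ)).IsRoot μ}.ncard = 2)
    (him : ∀ μ ∈ {μ : ℂ | (P.map (algebraMap ℝ ℂ)).IsRoot μ}, μ.im ≠ 0) :
    ∃ α β : ℝ, β ≠ 0 ∧ P = (X ^ 2 - C (2 * α) * X + C (α ^ 2 + β ^ 2)) *
      (X ^ 2 - C (2 * α) * X + C (α ^ 2 + β ^ 2)) := by
  set S := {μ : ℂ | (P.map (algebraMap ℝ ℂ)).IsRoot μ} with hS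
  have hroot : ∀ μ, μ ∈ S ↔ aeval μ P = 0 := fun μ => by
    rw [hS, Set.mem_ofPred_eq, IsRoot.def, eval_map_algebraMap]
  obtain ⟨z, hz⟩ : S.Nonempty := Set.nonempty_of_ncard_ne_zero (by omega)
  have hz' : (starRingEnd ℂ) z ∈ S := by
    rw [hroot, aeval_conj, (hroot z).1 hz, map_zero]
  have hne : z ≠ (starRingEnd ℂ) z := fun h => him z hz (Complex.conj_eq_iff_im.1 h.symm)
  have hfin : S.Finite := Set.finite_of_ncard_ne_zero (by omega)
  -- A real polynomial has conjugate roots, so the two nonreal roots are z and its conjugate.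
  have hSeq : {z, (starRingEnd ℂ) z} = S :=
    Set.eq_of_subset_of_ncard_le (Set.insert_subset hz (Set.singleton_subset_iff.2 hz'))
      (by rw [hcard, Set.ncard_pair hne]) hfin
  have hnorm : ‖z‖ ^ 2 = z.re ^ 2 + z.im ^ 2 := by
    rw [← Complex.normSq_eq_norm_sq, Complex.normSq_apply]; ring
  have hquad : ∀ w ∈ S, ∀ R : ℝ[X], aeval w R = 0 →
      X ^ 2 - C (2 * z.re) * X + C (z.re ^ 2 + z.im ^ 2) ∣ R := by
    intro w hw R hR
    have h := R.quadratic_dvd_of_aeval_eq_zero_im_ne_zero hR (him w hw)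
    rw [← hSeq] at hw
    rw [← hnorm]
    rcases hw with rfl | hw
    · exact h
    · rw [Set.mem_singleton_iff] at hw
      simpa [hw] using h
  refine ⟨z.re, z.im, him z hz, ?_⟩
  set q : ℝ[X] := X ^ 2 - C (2 * z.re) * X + C (z.re ^ 2 + z.im ^ 2) with hq
  have hqm : q.Monic := by rw [hq]; monicity!
  have hqd : q.natDegree = 2 := by rw [hq]; compute_degree!
  obtain ⟨r, hr⟩ := hquad z hz P ((hroot z).1 hz)
  have hrm : r.Monic := hqm.of_mul_monic_left (hr ▸ hP)
  have hrd : r.natDegree = 2 := by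
    have := hqm.natDegree_mul hrm
    rw [← hr] at this
    omega
  obtain ⟨w, hw⟩ := Complex.exists_root (f := r.map (algebraMap ℝ ℂ))
    (by rw [degree_map, degree_eq_natDegree hrm.ne_zero, hrd]; norm_num)
  rw [IsRoot.def, eval_map_algebraMap] at hw
  have hwS : w ∈ S := by rw [hroot, hr, map_mul, hw, mul_zero]
  -- A complex root of the cofactor is again z or its conjugate, so the same real quadratic divides
  -- the cofactor.
  have hrq : r = q := eq_of_monic_of_dvd_of_natDegree_le hqm hrm (hquad w hwS r hw) (by omega)
  rw [hr, hrq]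

variable {V : Type*} [AddCommGroup V] [Module ℝ V] [FiniteDimensional ℝ V]

/-- An endomorphism of a four-dimensional real vector space whose eigenvalues are two complex
conjugate numbers `α ± i β` is annihilated by `((X - α) ^ 2 + β ^ 2) ^ 2`. -/
theorem LinearMap.exists_of_two_nonreal_eigenvalues (hdim : Module.finrank ℝ V = 4)
    (A : Module.End ℝ V)
    (hcard : {μ : ℂ | (A.charpoly.map (algebraMap ℝ ℂ)).IsRoot μ}.ncard = 2)
    (him : ∀ μ ∈ {μ : ℂ | (A.charpoly.map (algebraMap ℝ ℂ)).IsRoot μ}, μ.im ≠ 0) :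
    ∃ α β : ℝ, β ≠ 0 ∧ LinearMap.trace ℝ V A = 4 * α ∧
      LinearMap.trace ℝ V (A * A) = 4 * (α ^ 2 - β ^ 2) ∧
      ((A - α • 1) * (A - α • 1) + β ^ 2 • 1) * ((A - α • 1) * (A - α • 1) + β ^ 2 • 1) = 0 := by
  have : Nontrivial V := Module.nontrivial_of_finrank_pos (R := ℝ) (by omega)
  obtain ⟨α, β, hβ, hP⟩ := Polynomial.exists_eq_quadratic_sq A.charpoly_monic
    (A.charpoly_natDegree.trans hdim) hcard him
  set q : ℝ[X] := X ^ 2 - C (2 * α) * X + C (α ^ 2 + β ^ 2) with hq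
  have hqm : q.Monic := by rw [hq]; monicity!
  have hqd : q.natDegree = 2 := by rw [hq]; compute_degree!
  have hqn : q.nextCoeff = -(2 * α) := by
    rw [nextCoeff_of_natDegree_pos (by omega), hqd, hq]
    simp only [coeff_add, coeff_sub, coeff_X_pow, coeff_C_mul, coeff_C]
    norm_num
  have htr : LinearMap.trace ℝ V A = 4 * α := by
    rw [A.trace_eq_neg_nextCoeff_charpoly, hP, hqm.nextCoeff_mul hqm, hqn]
    ring
  have hqA : aeval A q = (A - α • 1) * (A - α • 1) + β ^ 2 • 1 := by
    rw [hq]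
    simp only [map_add, map_sub, map_mul, aeval_X, aeval_C, Algebra.algebraMap_eq_smul_one,
      sub_mul, mul_sub, smul_mul_assoc, mul_smul_comm, one_mul, mul_one, sq]
    module
  have hnil : ((A - α • 1) * (A - α • 1) + β ^ 2 • 1) * ((A - α • 1) * (A - α • 1) + β ^ 2 • 1) = 0 := by
    rw [← hqA, ← map_mul, ← hP]
    exact A.aeval_self_charpoly
  refine ⟨α, β, hβ, htr, ?_, hnil⟩
  -- q(A) has square zero, hence trace zero; expanding gives tr A² in terms of α and β.
  have h0 := (LinearMap.isNilpotent_trace_of_isNilpotent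
    (f := (A - α • 1) * (A - α • 1) + β ^ 2 • 1) ⟨2, by rw [sq, hnil]⟩).eq_zero
  have h1 : (A - α • 1) * (A - α • 1) + β ^ 2 • 1 =
      A * A - (2 * α) • A + (α ^ 2 + β ^ 2) • (1 : Module.End ℝ V) := by
    simp only [sub_mul, mul_sub, smul_mul_assoc, mul_smul_comm, one_mul, mul_one, sq]
    module
  rw [h1, map_add, map_sub, map_smul, map_smul, htr, LinearMap.trace_one, hdim, smul_eq_mul,
    smul_eq_mul] at h0
  push_cast at h0
  linarith

theorem LinearMap.eq_zero_of_apply_eq_smul {A : Module.End ℝ V}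
    (him : ∀ μ ∈ {μ : ℂ | (A.charpoly.map (algebraMap ℝ ℂ)).IsRoot μ}, μ.im ≠ 0)
    {r : ℝ} {v : V} (hv : A v = r • v) : v = 0 := by
  by_contra hne
  have h := (Module.End.hasEigenvalue_iff_isRoot_charpoly A r).1
    (Module.End.hasEigenvalue_of_hasEigenvector (Module.End.hasEigenvector_iff.2
      ⟨Module.End.mem_eigenspace_iff.2 hv, hne⟩))
  exact him (r : ℂ) (h.map (f := algebraMap ℝ ℂ)) (Complex.ofReal_im r)

end Endomorphisms

theorem ContinuousLinearMap.quadratic_sq_eq_zero {E : Type*} [NormedAddCommGroup E]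
    [NormedSpace ℝ E] {A : E →L[ℝ] E} {α γ : ℝ}
    (h : ((A.toLinearMap - α • 1) * (A.toLinearMap - α • 1) + γ • 1) *
      ((A.toLinearMap - α • 1) * (A.toLinearMap - α • 1) + γ • 1) = 0) :
    ((A - α • 1) * (A - α • 1) + γ • 1) * ((A - α • 1) * (A - α • 1) + γ • 1) = 0 :=
  ContinuousLinearMap.ext fun v => LinearMap.congr_fun h v

/-! ### Independence of the charts -/

section ChartInvariance

variable {m n : ℕ}
  {M : Type*} [TopologicalSpace M] [ChartedSpace (EuclideanSpace ℝ (Fin m)) M]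
  [IsManifold (𝓡 m) ∞ M]
  {N : Type*} [TopologicalSpace N] [ChartedSpace (EuclideanSpace ℝ (Fin n)) N]
  [IsManifold (𝓡 n) ∞ N]
  {g : PseudoRiemannianMetric n N} {x : M → N} {ξ : ∀ p : M, TangentSpace (𝓡 n) (x p)} {ε : ℝ}

/-- The shape operator in the coordinates around `p₀`. -/
def shapeOpInChart (g : PseudoRiemannianMetric n N) (x : M → N)
    (ξ : ∀ p : M, TangentSpace (𝓡 n) (x p)) (p₀ : M) (y : Coord m) : Coord m →L[ℝ] Coord m :=
  shapeOp (g.inChart (x p₀)) (mapInChart x p₀) (fieldInChart x ξ p₀) y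

/-- The shape operator, on the fixed model of the tangent spaces. -/
def coordShapeOperator (g : PseudoRiemannianMetric n N) (x : M → N)
    (ξ : ∀ p : M, TangentSpace (𝓡 n) (x p)) (p : M) : Module.End ℝ (Coord m) :=
  (shapeOpInChart (m := m) g x ξ p (extChartAt (𝓡 m) p p)).toLinearMap

/-- In any chart, the shape operator is conjugate to `shapeOperator`. -/
theorem exists_conj_shapeOpInChart (hmn : n = m + 1) (hx : IsNondegenerateImmersion m g x)
    (hξ : IsUnitNormal m g x ξ ε) {p₀ : M} {y : Coord m}
    (hy : y ∈ mapChartDomain (n := n) x p₀) :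
    ∃ e : Coord m ≃ₗ[ℝ] Coord m, coordShapeOperator g x ξ ((extChartAt (𝓡 m) p₀).symm y) =
      e.conj (shapeOpInChart g x ξ p₀ y).toLinearMap := by
  set p := (extChartAt (𝓡 m) p₀).symm y with hp
  have hyp : (extChartAt (𝓡 m) p₀).symm y ∈ (extChartAt (𝓡 m) p).source :=
    mem_extChartAt_source p
  have hz : mapInChart x p₀ y ∈ (extChartAt (𝓡 n) (x p₀)).target :=
    (extChartAt (𝓡 n) (x p₀)).map_source hy.2
  have hsymm : ∀ w ∈ mapChartDomain (n := n) x p₀,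
      (extChartAt (𝓡 n) (x p₀)).symm (mapInChart x p₀ w) = x ((extChartAt (𝓡 m) p₀).symm w) :=
    fun w hw => (extChartAt (𝓡 n) (x p₀)).left_inv hw.2
  have hz' : (extChartAt (𝓡 n) (x p₀)).symm (mapInChart x p₀ y) ∈
      (extChartAt (𝓡 n) (x p)).source := by
    rw [hsymm y hy]
    exact mem_extChartAt_source (x p)
  have hev : ∀ᶠ w in nhds y, w ∈ mapChartDomain (n := n) x p₀ ∧
      (extChartAt (𝓡 m) p₀).symm w ∈ (extChartAt (𝓡 m) p).source ∧
      x ((extChartAt (𝓡 m) p₀).symm w) ∈ (extChartAt (𝓡 n) (x p)).source := by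
    have h1 := (contMDiffAt_extChartAt_symm hy.1).continuousAt
    have h2 := hx.smooth.continuous.continuousAt.comp (x := y) h1
    exact Filter.Eventually.and
      ((isOpen_mapChartDomain hx.smooth.continuous p₀).mem_nhds hy) (Filter.Eventually.and
      (h1.preimage_mem_nhds ((isOpen_extChartAt_source p).mem_nhds hyp))
      (h2.preimage_mem_nhds ((isOpen_extChartAt_source (x p)).mem_nhds
        (mem_extChartAt_source (x p)))))
  have key := fderiv_shapeOp_of_isometry (τ := transition p₀ p) (σ := transition (x p₀) (x p))
    (isLocalHypersurface_inChart hmn hx hξ p₀) (isLocalHypersurface_inChart hmn hx hξ p) hy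
    (extChartAt_self_mem_mapChartDomain p) (contDiffAt_transition hz hz')
    (g.inChart_eventuallyEq hz hz')
    ((contDiffAt_transition hy.1 hyp).differentiableAt (by simp))
    (by
      filter_upwards [hev] with w hw
      have h3 := (extChartAt (𝓡 m) p).left_inv hw.2.1
      simp only [Function.comp_apply, transition, mapInChart, h3]
      exact congrArg (extChartAt (𝓡 n) (x p)) ((extChartAt (𝓡 n) (x p₀)).left_inv hw.1.2))
    (by
      filter_upwards [hev] with w hw
      have h3 := (extChartAt (𝓡 m) p).left_inv hw.2.1
      have hw1 : mapInChart x p₀ w ∈ (extChartAt (𝓡 n) (x p₀)).target :=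
        (extChartAt (𝓡 n) (x p₀)).map_source hw.1.2
      have hw2 : (extChartAt (𝓡 n) (x p₀)).symm (mapInChart x p₀ w) ∈
        (extChartAt (𝓡 n) (x p)).source := by rw [hsymm w hw.1]; exact hw.2.2
      rw [fderiv_transition hw1 hw2, hsymm w hw.1]
      have h4 : fieldInChart x ξ p₀ w = chartDeriv (x p₀) (x ((extChartAt (𝓡 m) p₀).symm w))
        (ξ ((extChartAt (𝓡 m) p₀).symm w)) := rfl
      rw [h4]
      erw [chartSymmDeriv_chartDeriv hw.1.2]
      exact congrArg (fun r : M => (chartDeriv (x p) (x r) (ξ r) : Coord n)) h3.symm)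
  -- The conjugating map is the derivative of the transition from the chart at `p₀` to the preferred
  -- chart at `p`, in which `shapeOperator` is computed.
  refine ⟨LinearEquiv.ofInjectiveEndo (fderiv ℝ (transition p₀ p) y).toLinearMap
    (fderiv_transition_injective hy.1 hyp), ?_⟩
  refine LinearMap.ext fun v => ?_
  obtain ⟨u, rfl⟩ := (LinearEquiv.ofInjectiveEndo (fderiv ℝ (transition p₀ p) y).toLinearMap
    (fderiv_transition_injective hy.1 hyp)).surjective v
  rw [LinearEquiv.conj_apply_apply, LinearEquiv.symm_apply_apply]
  exact (key u).symm

omit [IsManifold (𝓡 m) ∞ M] in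
theorem meanCurvature_eq (hξ : IsUnitNormal m g x ξ ε) (p : M) :
    meanCurvature m g x ξ p =
      1 / (m : ℝ) * ε * LinearMap.trace ℝ (Coord m) (coordShapeOperator g x ξ p) := by
  rw [← hξ.inner_self p]
  rfl

/-- The mean curvature in coordinates. -/
theorem meanCurvature_extChartAt_symm (hmn : n = m + 1) (hx : IsNondegenerateImmersion m g x)
    (hξ : IsUnitNormal m g x ξ ε) {p₀ : M} {y : Coord m}
    (hy : y ∈ mapChartDomain (n := n) x p₀) :
    meanCurvature m g x ξ ((extChartAt (𝓡 m) p₀).symm y) =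
      1 / (m : ℝ) * ε * LinearMap.trace ℝ (Coord m) (shapeOpInChart g x ξ p₀ y).toLinearMap := by
  obtain ⟨e, he⟩ := exists_conj_shapeOpInChart hmn hx hξ hy
  rw [meanCurvature_eq hξ, he, LinearMap.trace_conj']

end ChartInvariance

/-! ### Hypersurfaces with proper mean curvature vector field -/

section ProperMeanCurvature

variable {m n : ℕ}
  {M : Type*} [TopologicalSpace M] [ChartedSpace (EuclideanSpace ℝ (Fin m)) M]
  [IsManifold (𝓡 m) ∞ M]
  {N : Type*} [TopologicalSpace N] [ChartedSpace (EuclideanSpace ℝ (Fin n)) N]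
  [IsManifold (𝓡 n) ∞ N]
  {g : PseudoRiemannianMetric n N} {x : M → N} {ξ : ∀ p : M, TangentSpace (𝓡 n) (x p)} {ε : ℝ}
  {c lam : ℝ}

-- Puts the hypothesis in the form φ ν required by the local results; at the base point of its own
-- chart the chart derivative is the identity.
omit [IsManifold (𝓡 m) ∞ M] in
theorem laplacian_meanCurvatureVector (hlam : HasProperMeanCurvature m g x ξ lam) (p : M) :
    laplacian (g.inChart (x p)) (mapInChart x p)
        (fun z => meanCurvature m g x ξ ((extChartAt (𝓡 m) p).symm z) •
          fieldInChart (m := m) x ξ p z) (extChartAt (𝓡 m) p p) =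
      lam • meanCurvature m g x ξ p • fieldInChart (m := m) x ξ p (extChartAt (𝓡 m) p p) := by
  have h1 : fieldInChart x (meanCurvatureVector m g x ξ) p =
      fun z => meanCurvature m g x ξ ((extChartAt (𝓡 m) p).symm z) •
        fieldInChart (m := m) x ξ p z :=
    funext fun z => (chartDeriv (x p) (x ((extChartAt (𝓡 m) p).symm z))).map_smul _ _
  have h2 : fieldInChart (m := m) x ξ p (extChartAt (𝓡 m) p p) = ξ p := by
    have h3 : (extChartAt (𝓡 m) p).symm (extChartAt (𝓡 m) p p) = p :=
      (extChartAt (𝓡 m) p).left_inv (mem_extChartAt_source p)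
    have h4 := congrArg (fun r : M => (chartDeriv (x p) (x r) (ξ r) : Coord n)) h3
    refine h4.trans ?_
    rw [chartDeriv_self]
    rfl
  have h := hlam p
  rw [← h1, h2]
  exact h

/-- The mean curvature of a connected hypersurface with proper mean curvature vector field and no
real principal curvature is constant. -/
theorem meanCurvature_eq_of_properMeanCurvature [ConnectedSpace M] (hm : m ≠ 0) (hmn : n = m + 1)
    (hc : g.HasConstantSectionalCurvature c) (hx : IsNondegenerateImmersion m g x)
    (hξ : IsUnitNormal m g x ξ ε) (hlam : HasProperMeanCurvature m g x ξ lam)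
    (him : ∀ p : M, ∀ μ ∈ principalCurvatures m g x ξ p, μ.im ≠ 0) (p q : M) :
    meanCurvature m g x ξ p = meanCurvature m g x ξ q := by
  have hε : ε ≠ 0 := by rcases hξ.sign with h | h <;> simp [h]
  -- The equation at `p` is stated in the chart centred at `p`, so the derivative is first known
  -- only at that centre.
  have hder : ∀ p : M, HasFDerivAt
      (fun z => meanCurvature m g x ξ ((extChartAt (𝓡 m) p).symm z))
      (0 : Coord m →L[ℝ] ℝ) (extChartAt (𝓡 m) p p) := by
    intro p
    have hf := isLocalHypersurface_inChart hmn hx hξ p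
    have hy := extChartAt_self_mem_mapChartDomain (m := m) (n := n) (x := x) p
    have h3 : (extChartAt (𝓡 m) p).symm (extChartAt (𝓡 m) p p) = p :=
      (extChartAt (𝓡 m) p).left_inv (mem_extChartAt_source p)
    have hφ : ∀ z ∈ mapChartDomain (n := n) x p,
        meanCurvature m g x ξ ((extChartAt (𝓡 m) p).symm z) = 1 / (m : ℝ) * ε *
          LinearMap.trace ℝ (Coord m) (shapeOp (g.inChart (x p)) (mapInChart x p)
            (fieldInChart x ξ p) z).toLinearMap := fun z hz =>
      meanCurvature_extChartAt_symm hmn hx hξ hz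
    have hlap := laplacian_meanCurvatureVector hlam p
    -- The local lemma is used with λH(p) as its constant: only normality of the Laplacian matters
    -- there.
    rw [smul_smul] at hlap
    have h0 := hf.fderiv_meanCurvature_eq_zero hy (hc.curvature_eq (n := n) (by omega) (x p))
      (by positivity) hφ hlap
      (fun r v hv => LinearMap.eq_zero_of_apply_eq_smul (him p) (r := r) (v := v) hv)
    have hd : DifferentiableAt ℝ
        (fun z => meanCurvature m g x ξ ((extChartAt (𝓡 m) p).symm z)) (extChartAt (𝓡 m) p p) := by
      have h4 := (contDiffAt_const (c := 1 / (m : ℝ) * ε)).mul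
        (contDiffAt_trace (hf.contDiffAt_shapeOp hy))
      refine (h4.differentiableAt (by simp)).congr_of_eventuallyEq ?_
      filter_upwards [hf.mem_nhds hy] with z hz using hφ z hz
    rw [← h0]
    exact hd.hasFDerivAt
  refine IsLocallyConstant.apply_eq_of_preconnectedSpace
    ((IsLocallyConstant.iff_eventually_eq _).2 fun p => ?_) p q
  -- Vanishing at the centres of all charts spreads over one chart through the transition maps.
  have hder' : ∀ z ∈ (extChartAt (𝓡 m) p).target, HasFDerivAt
      (fun z => meanCurvature m g x ξ ((extChartAt (𝓡 m) p).symm z))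
      (0 : Coord m →L[ℝ] ℝ) z := by
    intro z hz
    have hz' : (extChartAt (𝓡 m) p).symm z ∈
      (extChartAt (𝓡 m) ((extChartAt (𝓡 m) p).symm z)).source := mem_extChartAt_source _
    have h1 := ((contDiffAt_transition hz hz').differentiableAt (by simp)).hasFDerivAt
    have h2 := (hder ((extChartAt (𝓡 m) p).symm z)).comp z h1
    rw [ContinuousLinearMap.zero_comp] at h2
    refine h2.congr_of_eventuallyEq ?_
    filter_upwards [eventually_transition hz hz'] with w hw
    exact congrArg _ (extChartAt_symm_transition hw.2).symm
  obtain ⟨r, hr, hball⟩ := Metric.isOpen_iff.1 (isOpen_extChartAt_target (I := 𝓡 m) p)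
    (extChartAt (𝓡 m) p p) (mem_extChartAt_target p)
  filter_upwards [(continuousAt_extChartAt (I := 𝓡 m) p).preimage_mem_nhds (Metric.ball_mem_nhds _ hr),
    (isOpen_extChartAt_source (I := 𝓡 m) p).mem_nhds (mem_extChartAt_source p)] with q hq hq'
  have h := Metric.isOpen_ball.is_const_of_fderiv_eq_zero (𝕜 := ℝ)
    (convex_ball (extChartAt (𝓡 m) p p) r).isPreconnected
    (fun z hz => (hder' z (hball hz)).differentiableAt.differentiableWithinAt)
    (fun z hz => (hder' z (hball hz)).fderiv) hq (Metric.mem_ball_self hr)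
  simpa only [(extChartAt (𝓡 m) p).left_inv hq',
    (extChartAt (𝓡 m) p).left_inv (mem_extChartAt_source p)] using h

/-- For a hypersurface with proper mean curvature vector field and constant nonzero mean
curvature, `tr A² = ε λ`. -/
theorem trace_sq_coordShapeOperator (hmn : n = m + 1)
    (hx : IsNondegenerateImmersion m g x) (hξ : IsUnitNormal m g x ξ ε)
    (hlam : HasProperMeanCurvature m g x ξ lam) {H : ℝ} (hH : H ≠ 0)
    (hconst : ∀ p : M, meanCurvature m g x ξ p = H) (p : M) :
    LinearMap.trace ℝ (Coord m) (coordShapeOperator g x ξ p * coordShapeOperator g x ξ p) =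
      ε * lam := by
  have hlap := laplacian_meanCurvatureVector hlam p
  simp only [hconst] at hlap
  exact (isLocalHypersurface_inChart hmn hx hξ p).trace_sq_shapeOp
    (extChartAt_self_mem_mapChartDomain p) hH hlap

end ProperMeanCurvature

/-- The relations between the curvature, the mean curvature and `λ` for a four-dimensional
hypersurface with proper mean curvature vector field and two imaginary principal curvatures. -/
theorem exists_principalCurvatures_of_meanCurvature_ne_zero
    {N : Type*} [TopologicalSpace N] [ChartedSpace (EuclideanSpace ℝ (Fin 5)) N]
    [IsManifold (𝓡 5) ∞ N]
    {M : Type*} [TopologicalSpace M] [ChartedSpace (EuclideanSpace ℝ (Fin 4)) M]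
    [IsManifold (𝓡 4) ∞ M] [ConnectedSpace M]
    {g : PseudoRiemannianMetric 5 N} {c : ℝ} (hc : g.HasConstantSectionalCurvature c)
    {x : M → N} (hx : IsNondegenerateImmersion 4 g x)
    {ξ : ∀ p : M, TangentSpace (𝓡 5) (x p)} {ε : ℝ} (hξ : IsUnitNormal 4 g x ξ ε)
    {lam : ℝ} (hlam : HasProperMeanCurvature 4 g x ξ lam)
    (hcurv : ∀ p : M, (principalCurvatures 4 g x ξ p).ncard = 2 ∧
      ∀ μ ∈ principalCurvatures 4 g x ξ p, μ.im ≠ 0)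
    {p₀ : M} (hp₀ : meanCurvature 4 g x ξ p₀ ≠ 0) :
    ∃ α β : ℝ, β ≠ 0 ∧ (∀ p : M, meanCurvature 4 g x ξ p = ε * α) ∧
      ε * lam = 4 * (α ^ 2 - β ^ 2) ∧ c + ε * (α ^ 2 + β ^ 2) = 0 := by
  have hεε : ε * ε = 1 := by rcases hξ.sign with h | h <;> simp [h]
  have hconst : ∀ p : M, meanCurvature 4 g x ξ p = meanCurvature 4 g x ξ p₀ := fun p =>
    meanCurvature_eq_of_properMeanCurvature (by norm_num) rfl hc hx hξ hlam
      (fun p => (hcurv p).2) p p₀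
  have hpt : ∀ p : M, ∃ α β : ℝ, β ≠ 0 ∧ meanCurvature 4 g x ξ p = ε * α ∧
      ε * lam = 4 * (α ^ 2 - β ^ 2) ∧
      ((coordShapeOperator (m := 4) g x ξ p - α • 1) * (coordShapeOperator g x ξ p - α • 1)
          + β ^ 2 • 1) * ((coordShapeOperator g x ξ p - α • 1) *
            (coordShapeOperator g x ξ p - α • 1) + β ^ 2 • 1) = 0 := by
    intro p
    obtain ⟨α, β, hβ, h1, h2, h3⟩ := LinearMap.exists_of_two_nonreal_eigenvalues (by simp)
      (coordShapeOperator (m := 4) g x ξ p) (hcurv p).1 (hcurv p).2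
    refine ⟨α, β, hβ, ?_, ?_, h3⟩
    · rw [meanCurvature_eq hξ, h1]
      push_cast
      ring
    · rw [← h2, trace_sq_coordShapeOperator rfl hx hξ hlam hp₀ hconst p]
  obtain ⟨α, β, hβ, h1, h2, -⟩ := hpt p₀
  have hH : ∀ p : M, meanCurvature 4 g x ξ p = ε * α := fun p => (hconst p).trans h1
  refine ⟨α, β, hβ, hH, h2, ?_⟩
  refine (isLocalHypersurface_inChart rfl hx hξ p₀).cartan_identity
    ⟨_, extChartAt_self_mem_mapChartDomain p₀⟩ (by simp)
    (hc.curvature_eq (by norm_num) (x p₀)) hβ fun y hy => ?_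
  obtain ⟨e, he⟩ := exists_conj_shapeOpInChart rfl hx hξ hy
  obtain ⟨α', β', -, h1', h2', h3'⟩ := hpt ((extChartAt (𝓡 4) p₀).symm y)
  -- The numbers α, β were chosen pointwise: constancy of H fixes α, and ελ = 4(α² - β²) then fixes
  -- β², leaving β free up to sign.
  have hα : α' = α := by
    have := (hH ((extChartAt (𝓡 4) p₀).symm y)).symm.trans h1'
    linear_combination (-ε) * this + (α - α') * hεε
  subst hα
  have hβ2 : β' ^ 2 = β ^ 2 := by linarith
  rw [hβ2, he] at h3'
  -- The quadratic relation holds for the shape operator in its own chart; conjugation carries it to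
  -- the chart at `p₀`.
  have hone : (1 : Module.End ℝ (Coord 4)) = e.conj 1 := e.conj_id.symm
  rw [hone] at h3'
  simp only [← map_smul, ← map_sub, ← map_add, Module.End.mul_eq_comp, ← LinearEquiv.conj_comp]
    at h3'
  exact ContinuousLinearMap.quadratic_sq_eq_zero (e.conj.map_eq_zero_iff.1 h3')

end

/-! ### The trichotomy for the mean curvature. -/

theorem theorem4p8
    {N : Type*} [TopologicalSpace N] [ChartedSpace (EuclideanSpace ℝ (Fin 5)) N]
    [IsManifold (𝓡 5) ∞ N]
    {M : Type*} [TopologicalSpace M] [ChartedSpace (EuclideanSpace ℝ (Fin 4)) M]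
    [IsManifold (𝓡 4) ∞ M] [ConnectedSpace M]
    (g : PseudoRiemannianMetric 5 N) (c : ℝ) (hc : g.HasConstantSectionalCurvature c)
    (x : M → N) (hx : IsNondegenerateImmersion 4 g x)
    (ξ : ∀ p : M, TangentSpace (𝓡 5) (x p)) (ε : ℝ) (hξ : IsUnitNormal 4 g x ξ ε)
    (lam : ℝ) (hlam : HasProperMeanCurvature 4 g x ξ lam)
    (hcurv : ∀ p : M, (principalCurvatures 4 g x ξ p).ncard = 2 ∧
      ∀ μ ∈ principalCurvatures 4 g x ξ p, μ.im ≠ 0) :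
    (0 ≤ c * ε → ∀ p : M, meanCurvature 4 g x ξ p = 0) ∧
    (c * ε < 0 → -4 * c * ε ≤ |ε * lam| → ∀ p : M, meanCurvature 4 g x ξ p = 0) ∧
    (c * ε < 0 → |ε * lam| < -4 * c * ε →
      (∀ p : M, meanCurvature 4 g x ξ p = 0) ∨
        ∀ p : M, meanCurvature 4 g x ξ p ^ 2 = (ε * lam - 4 * c * ε) / 8) := by
  have hεε : ε * ε = 1 := by rcases hξ.sign with h | h <;> simp [h]
  -- One point with H ≠ 0 already forces the third case and its second alternative; the three claims
  -- are then contrapositives.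
  have key : ∀ p₀ : M, meanCurvature 4 g x ξ p₀ ≠ 0 → c * ε < 0 ∧ |ε * lam| < -4 * c * ε ∧
      ∀ p : M, meanCurvature 4 g x ξ p ^ 2 = (ε * lam - 4 * c * ε) / 8 := by
    intro p₀ hp₀
    obtain ⟨α, β, hβ, hH, hlamε, hcar⟩ :=
      exists_principalCurvatures_of_meanCurvature_ne_zero hc hx hξ hlam hcurv hp₀
    have hα : α ≠ 0 := by
      rintro rfl
      exact hp₀ (by rw [hH, mul_zero])
    have hα2 : 0 < α ^ 2 := by positivity
    have hβ2 : 0 < β ^ 2 := by positivity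
    -- Cartan's identity multiplied by ε. Since -4cε = 4(α² + β²), the bound on |ελ| = 4|α² - β²| is
    -- strict because α² and β² are positive.
    have hcε : c * ε = -(α ^ 2 + β ^ 2) := by
      linear_combination ε * hcar - (α ^ 2 + β ^ 2) * hεε
    refine ⟨by linarith, ?_, fun p => ?_⟩
    · rw [abs_lt]
      constructor <;> linarith
    · rw [hH]
      linear_combination α ^ 2 * hεε - (1 / 8) * hlamε + (1 / 2) * hcε
  refine ⟨fun h p => ?_, fun _ h p => ?_, fun _ _ => ?_⟩
  · by_contra hp
    exact (key p hp).1.not_ge h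
  · by_contra hp
    exact (key p hp).2.1.not_ge h
  · by_cases h : ∀ p : M, meanCurvature 4 g x ξ p = 0
    · exact Or.inl h
    · obtain ⟨p, hp⟩ := not_forall.1 h
      exact Or.inr (key p hp).2.2
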